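/- **Theorem 3.5.** Let $\mathbb K$ be a field of characteristic $0$ with algebraic closure $\overline{\mathbb K}$, and let $p\in\mathbb K[z]$ be a non-zero polynomial having $0$ as a root of multiplicity $k\ge 1$; write $p(z)=z^k\tilde p(z)$. Let $q_+,q_-\in\mathbb K$ be such that $q:=q_+q_-\neq 0$. All algebras are associative and unital. Let $\mathcal B(p;q,0)$ be the $\mathbb K$-algebra generated by $x,y,z$ subject to $$xy=p(qz),\qquad yx=p(z),\qquad xz=qzx,\qquad yz=q^{-1}zy .$$ Let $\mathcal A=\mathcal A(p;q_\pm)$ be the $\mathbb K$-algebra generated by $z_\pm,x_\pm$ subject to $$z_+z_-=z_-z_+,\quad x_+x_-=\tilde p(z_+z_-),\quad x_-x_+=\tilde p(qz_+z_-),\quad x_+z_\pm=q_\pm^{-1}z_\pm x_+,\quad x_-z_\pm=q_\pm z_\pm x_- .$$ For $d\in\mathbb Z$ let $\mathcal A_d$ be the span of the words of degree $d$ in the generators, where $\deg z_\pm=\pm1$ and $\deg x_\pm=\pm k$. Let $\mathcal A^{(k)}=\bigoplus_{n\in\mathbb Z}\mathcal A_{nk}$ be the $k$-th Veronese subalgebra,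 with degree-$n$ component $\mathcal A^{(k)}_n:=\mathcal A_{nk}$. A $\mathbb Z$-graded algebra $\mathcal R=\bigoplus_n\mathcal R_n$ is *strongly graded* if $\mathcal R_m\mathcal R_n=\mathcal R_{m+n}$ for all $m,n\in\mathbb Z$. It is *projectively graded* if every $\mathcal R_n$ is a projective left $\mathcal R_0$-module. A projectively graded algebra is *non-degenerate* if, in addition, $\mathcal R_n$ is a finitely generated left $\mathcal R_0$-module for all $n\ne0$ and $\mathcal R_m\not\cong\mathcal R_n$ as left $\mathcal R_0$-modules whenever $m\neq n$. 1. $\mathcal A=\bigoplus_{d}\mathcal A_d$ is $\mathbb Z$-graded, $\mathcal A^{(k)}$ is strongly $\mathbb Z$-graded, and its degree-zero part is $\mathcal B(p;q,0)$: there is a $\mathbb K$-algebra isomorphism $\varphi:\mathcal B(p;q,0)\to\mathcal A^{(k)}_0$ with $\varphi(x)=x_-z_+^k$, $\varphi(y)=z_-^kx_+$, $\varphi(z)=z_+z_-$. 2. Suppose that $q$ is not a root of unity. Then $\mathcal A^{(k)}$ is a non-degenerate projectively graded algebra if and only if $p$ has a non-zero root in $\overline{\mathbb K}$. 3. Suppose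 that $q$ is not a root of unity and let $\zeta\in\overline{\mathbb K}$ be a non-zero root of $p$. There is exactly one $\mathbb K$-linear map $\tau_\zeta:\mathcal B(p;q,0)\to\overline{\mathbb K}$ such that, for all $m,n\ge0$, $$\tau_\zeta(x^mz^n)=\tau_\zeta(y^mz^n)=\begin{cases}\dfrac{\zeta^n}{1-q^n}&\text{if }m=0,\ n\neq0,\\[2mm]0&\text{otherwise,}\end{cases}$$ and $\tau_\zeta(ab)=\tau_\zeta(ba)$ for all $a,b$. For every $n\in\mathbb Z$ and every idempotent matrix $E\in M_N(\mathcal A^{(k)}_0)$ such that $\mathcal A^{(k)}_n\cong(\mathcal A^{(k)}_0)^N E$ as left $\mathcal A^{(k)}_0$-modules (row vectors), $$\tau_\zeta\big(\varphi^{-1}(\operatorname{Tr}E)\big)=-n .$$ Moreover, for $n\neq0$, $\mathcal A^{(k)}_n$ is not a free left $\mathcal A^{(k)}_0$-module. -/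

import Mathlib

open Polynomial

namespace CircleBundle

section Graded

variable {K R : Type*} [Field K] [Ring R] [Algebra K R]

/-- A strongly `ℤ`-graded algebra: `R` is the internal direct sum of the components, the unit has
degree zero, and the span of the products of elements of degrees `m` and `n` is exactly the
component of degree `m + n`. -/
structure IsStronglyGraded (𝒜 : ℤ → Submodule K R) : Prop where
  isInternal : DirectSum.IsInternal 𝒜
  one_mem : (1 : R) ∈ 𝒜 0
  mul_eq : ∀ m n : ℤ, 𝒜 m * 𝒜 n = 𝒜 (m + n)

/-- The degree-zero part of a graded algebra, as a subalgebra. -/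
abbrev degreeZero (𝒜 : ℤ → Submodule K R) [SetLike.GradedMonoid 𝒜] : Subalgebra K R :=
  SetLike.GradeZero.subalgebra 𝒜

/-- The component of degree `n` as a left module over the degree-zero part, the action being the
left multiplication in the algebra. -/
def leftComponent (𝒜 : ℤ → Submodule K R) [SetLike.GradedMonoid 𝒜] (n : ℤ) :
    Submodule (degreeZero 𝒜) R where
  carrier := 𝒜 n
  add_mem' := (𝒜 n).add_mem
  zero_mem' := (𝒜 n).zero_mem
  smul_mem' a x hx := by
    have h := SetLike.mul_mem_graded (A := 𝒜) (i := 0) (j := n) a.2 hx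
    rw [zero_add] at h
    exact h

/-- A projectively graded algebra: a `ℤ`-graded algebra, all of whose components are projective
left modules over the degree-zero part. -/
structure IsProjectivelyGraded (𝒜 : ℤ → Submodule K R) [SetLike.GradedMonoid 𝒜] : Prop where
  isInternal : DirectSum.IsInternal 𝒜
  projective : ∀ n : ℤ, Module.Projective (degreeZero 𝒜) (leftComponent 𝒜 n)

/-- A non-degenerate projectively graded algebra. -/
structure IsNonDegenerateProjectivelyGraded (𝒜 : ℤ → Submodule K R) [SetLike.GradedMonoid 𝒜] :
    Prop where
  isProjectivelyGraded : IsProjectivelyGraded 𝒜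
  finite : ∀ n : ℤ, n ≠ 0 → Module.Finite (degreeZero 𝒜) (leftComponent 𝒜 n)
  not_iso : ∀ m n : ℤ, m ≠ n →
    IsEmpty (leftComponent 𝒜 m ≃ₗ[degreeZero 𝒜] leftComponent 𝒜 n)

/-- The component of degree `n` is a free left module over the degree-zero part. -/
def IsFreeComponent (𝒜 : ℤ → Submodule K R) [SetLike.GradedMonoid 𝒜] (n : ℤ) : Prop :=
  Module.Free (degreeZero 𝒜) (leftComponent 𝒜 n)

/-- The square matrix `E` over the degree-zero part is an idempotent, and the component of degree
`n` is isomorphic, as a left module over the degree-zero part, to the module of the row vectors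
`v ᵥ* E`. -/
structure IsIdempotentFor (𝒜 : ℤ → Submodule K R) [SetLike.GradedMonoid 𝒜] (n : ℤ) {N : ℕ}
    (E : Matrix (Fin N) (Fin N) (degreeZero 𝒜)) : Prop where
  mul_self : E * E = E
  iso : Nonempty (leftComponent 𝒜 n ≃ₗ[degreeZero 𝒜] LinearMap.range (Matrix.vecMulLinear E))

/-- The `k`-th Veronese subalgebra: the sum of the components whose degree is a multiple
of `k`. -/
def veronese (𝒜 : ℤ → Submodule K R) [SetLike.GradedMonoid 𝒜] (k : ℕ) : Subalgebra K R :=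
  (⨆ n : ℤ, 𝒜 (n * k)).toSubalgebra
    (Submodule.mem_iSup_of_mem 0 (by
      rw [zero_mul]
      exact SetLike.GradedOne.one_mem))
    (by
      intro a b ha hb
      have h := Submodule.mul_mem_mul ha hb
      rw [Submodule.iSup_mul] at h
      simp_rw [Submodule.mul_iSup] at h
      refine (iSup_le fun m => iSup_le fun n => ?_ :
        (⨆ m : ℤ, ⨆ n : ℤ, 𝒜 (m * k) * 𝒜 (n * k)) ≤ ⨆ n : ℤ, 𝒜 (n * k)) h
      refine le_trans ?_ (le_iSup (fun n : ℤ => 𝒜 (n * k)) (m + n))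
      rw [Submodule.mul_le]
      intro x hx y hy
      rw [add_mul]
      exact SetLike.GradedMul.mul_mem hx hy)

/-- The grading of the `k`-th Veronese subalgebra: an element has degree `n` if it has degree
`n * k` in the original algebra. -/
def veroneseGrading (𝒜 : ℤ → Submodule K R) [SetLike.GradedMonoid 𝒜] (k : ℕ) (n : ℤ) :
    Submodule K (veronese 𝒜 k) :=
  (𝒜 (n * k)).comap (veronese 𝒜 k).val.toLinearMap

instance veroneseGrading.gradedMonoid (𝒜 : ℤ → Submodule K R) [SetLike.GradedMonoid 𝒜] (k : ℕ) :
    SetLike.GradedMonoid (veroneseGrading 𝒜 k) where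
  one_mem := by
    change (1 : R) ∈ 𝒜 (0 * k)
    rw [zero_mul]
    exact SetLike.GradedOne.one_mem
  mul_mem := by
    intro m n x y hx hy
    change (x : R) * (y : R) ∈ 𝒜 ((m + n) * k)
    rw [add_mul]
    exact SetLike.GradedMul.mul_mem hx hy

end Graded

/-! ### The generalized Weyl algebra over `K[z]` -/

inductive WeylGen
  | x
  | y
  | z

section Weyl

variable {K : Type*} [Field K]

inductive WeylRel (p : K[X]) (q r : K) : FreeAlgebra K WeylGen → FreeAlgebra K WeylGen → Prop
  | xy : WeylRel p q r (FreeAlgebra.ι K .x * FreeAlgebra.ι K .y)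
      (aeval (q • FreeAlgebra.ι K WeylGen.z + algebraMap K _ r) p)
  | yx : WeylRel p q r (FreeAlgebra.ι K .y * FreeAlgebra.ι K .x)
      (aeval (FreeAlgebra.ι K WeylGen.z) p)
  | xz : WeylRel p q r (FreeAlgebra.ι K .x * FreeAlgebra.ι K .z)
      ((q • FreeAlgebra.ι K .z + algebraMap K _ r) * FreeAlgebra.ι K .x)
  | yz : WeylRel p q r (FreeAlgebra.ι K .y * FreeAlgebra.ι K .z)
      ((q⁻¹ • (FreeAlgebra.ι K .z - algebraMap K _ r)) * FreeAlgebra.ι K .y)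

/-- The algebra `B(p;q,r)` with generators `x, y, z` and relations
`xy = p(qz + r)`, `yx = p(z)`, `xz = (qz + r)x`, `yz = q⁻¹(z - r)y`. -/
def Weyl (p : K[X]) (q r : K) : Type _ := RingQuot (WeylRel p q r)

noncomputable instance Weyl.ring (p : K[X]) (q r : K) : Ring (Weyl p q r) :=
  inferInstanceAs (Ring (RingQuot (WeylRel p q r)))

noncomputable instance Weyl.algebra (p : K[X]) (q r : K) : Algebra K (Weyl p q r) :=
  inferInstanceAs (Algebra K (RingQuot (WeylRel p q r)))

noncomputable def Weyl.gen (p : K[X]) (q r : K) (g : WeylGen) : Weyl p q r :=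
  RingQuot.mkAlgHom K (WeylRel p q r) (FreeAlgebra.ι K g)

/-- The functional `τ_ζ` on `B(p;q,0)`, described by its values on the monomials `x ^ m * z ^ n`
and `y ^ m * z ^ n`: these are `ζ ^ n / (1 - q ^ n)` if `m = 0` and `n ≠ 0`, and `0` otherwise.
Here `ζ` and the values lie in an extension `L` of `K`. -/
def IsTau {L : Type*} [Field L] [Algebra K L] (p : K[X]) (q : K) (ζ : L)
    (τ : Weyl p q 0 →ₗ[K] L) : Prop :=
  ∀ m n : ℕ,
    τ (Weyl.gen p q 0 .x ^ m * Weyl.gen p q 0 .z ^ n) =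
        (if m = 0 ∧ n ≠ 0 then ζ ^ n / (1 - algebraMap K L q ^ n) else 0) ∧
    τ (Weyl.gen p q 0 .y ^ m * Weyl.gen p q 0 .z ^ n) =
        (if m = 0 ∧ n ≠ 0 then ζ ^ n / (1 - algebraMap K L q ^ n) else 0)

end Weyl

/-! ### The generalized Weyl algebra over `K[z₊, z₋]` -/

inductive CircleGen
  | zp
  | zm
  | xp
  | xm

section Circle

variable {K : Type*} [Field K]

inductive CircleRel (pt : K[X]) (qp qm : K) :
    FreeAlgebra K CircleGen → FreeAlgebra K CircleGen → Prop
  | zz : CircleRel pt qp qm (FreeAlgebra.ι K .zp * FreeAlgebra.ι K .zm)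
      (FreeAlgebra.ι K .zm * FreeAlgebra.ι K .zp)
  | xpxm : CircleRel pt qp qm (FreeAlgebra.ι K .xp * FreeAlgebra.ι K .xm)
      (aeval (FreeAlgebra.ι K CircleGen.zp * FreeAlgebra.ι K CircleGen.zm) pt)
  | xmxp : CircleRel pt qp qm (FreeAlgebra.ι K .xm * FreeAlgebra.ι K .xp)
      (aeval ((qp * qm) • (FreeAlgebra.ι K CircleGen.zp * FreeAlgebra.ι K CircleGen.zm)) pt)
  | xpzp : CircleRel pt qp qm (FreeAlgebra.ι K .xp * FreeAlgebra.ι K .zp)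
      (qp⁻¹ • (FreeAlgebra.ι K .zp * FreeAlgebra.ι K .xp))
  | xpzm : CircleRel pt qp qm (FreeAlgebra.ι K .xp * FreeAlgebra.ι K .zm)
      (qm⁻¹ • (FreeAlgebra.ι K .zm * FreeAlgebra.ι K .xp))
  | xmzp : CircleRel pt qp qm (FreeAlgebra.ι K .xm * FreeAlgebra.ι K .zp)
      (qp • (FreeAlgebra.ι K .zp * FreeAlgebra.ι K .xm))
  | xmzm : CircleRel pt qp qm (FreeAlgebra.ι K .xm * FreeAlgebra.ι K .zm)
      (qm • (FreeAlgebra.ι K .zm * FreeAlgebra.ι K .xm))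

/-- The algebra `A(p;q₊,q₋)` attached to `p = z ^ k * pt`. It has generators `z₊, z₋, x₊, x₋` and
relations `z₊z₋ = z₋z₊`, `x₊x₋ = pt(z₊z₋)`, `x₋x₊ = pt(q₊q₋z₊z₋)`, `x₊z± = q±⁻¹z±x₊`,
`x₋z± = q±z±x₋`. -/
def Circle (pt : K[X]) (qp qm : K) : Type _ := RingQuot (CircleRel pt qp qm)

noncomputable instance Circle.ring (pt : K[X]) (qp qm : K) : Ring (Circle pt qp qm) :=
  inferInstanceAs (Ring (RingQuot (CircleRel pt qp qm)))

noncomputable instance Circle.algebra (pt : K[X]) (qp qm : K) : Algebra K (Circle pt qp qm) :=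
  inferInstanceAs (Algebra K (RingQuot (CircleRel pt qp qm)))

noncomputable def Circle.gen (pt : K[X]) (qp qm : K) (g : CircleGen) : Circle pt qp qm :=
  RingQuot.mkAlgHom K (CircleRel pt qp qm) (FreeAlgebra.ι K g)

/-- The degrees of the generators: `±1` for `z±` and `±k` for `x±`. -/
def CircleGen.degree (k : ℕ) : CircleGen → ℤ
  | .zp => 1
  | .zm => -1
  | .xp => k
  | .xm => -k

/-- The component of degree `d` of `A(p;q₊,q₋)`: the span of the words of degree `d` in the
generators. -/
noncomputable def Circle.grading (pt : K[X]) (qp qm : K) (k : ℕ) (d : ℤ) : Submodule K (Circle pt qp qm) :=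
  Submodule.span K {a | ∃ w : List CircleGen,
    (w.map (CircleGen.degree k)).sum = d ∧ (w.map (Circle.gen pt qp qm)).prod = a}

instance Circle.gradedMonoid (pt : K[X]) (qp qm : K) (k : ℕ) :
    SetLike.GradedMonoid (Circle.grading pt qp qm k) where
  one_mem := Submodule.subset_span ⟨[], by simp, by simp⟩
  mul_mem := by
    intro i j a b ha hb
    have h := Submodule.mul_mem_mul ha hb
    unfold Circle.grading at h
    rw [Submodule.span_mul_span] at h
    refine Submodule.span_mono ?_ h
    rintro _ ⟨a, ⟨v, hv, rfl⟩, b, ⟨w, hw, rfl⟩, rfl⟩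
    exact ⟨v ++ w, by simp [hv, hw], by simp⟩

/-- The grading of the `k`-th Veronese subalgebra `A(p;q₊,q₋)^(k)`. -/
noncomputable abbrev Circle.veroneseGrading (pt : K[X]) (qp qm : K) (k : ℕ) :
    ℤ → Submodule K (veronese (Circle.grading pt qp qm k) k) :=
  CircleBundle.veroneseGrading (Circle.grading pt qp qm k) k

end Circle

end CircleBundle

open CircleBundle

/-! Write `w = z₊z₋`. Every assertion comes down to computations with polynomials in `w`. Grading:
the relations are homogeneous, so sending each generator `g` to `g T^(deg g)` defines an algebra map
into Laurent polynomials over the algebra; it reads off degrees and makes the components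
independent. Degree zero: ordered monomials `z₊ᵃ z₋ᵇ x±ᵐ` span the algebra, and those of degree zero
are scalar multiples of powers of `w` times powers of the images of `x` or `y`, so `φ` is onto. A
representation on functions `ℤ → K[X]` separates the elements `xⁿ f(z)`, `yⁿ f(z)`, which gives
injectivity and a basis of the Weyl algebra together. Strong grading: `pt(0) ≠ 0`, so `pt` and its
dilation are coprime to `z ^ k`. Bézout identities yield families with `∑ aᵢ bᵢ = 1` in degrees `∓1`
of the Veronese subalgebra, and nesting them yields such families for all `n`. They present the
component of degree `n` by the idempotent `(bᵢ aⱼ)`, whose trace `∑ bᵢ aᵢ` is a polynomial `fₙ(w)`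
with `fₙ(0) = 1` (`Circle.exists_isDualFamily`). Trace: on polynomials, `τ_ζ` satisfies `τ(g(qz)) =
τ(g) - g(ζ) + g(0)`. Passing from `fₙ` to `fₙ₊₁` undoes a dilation of a polynomial divisible by `pt`
with value `1` at `0`, so `τ` drops by exactly `1`; hence `τ(fₙ) = -n`. The same identity makes
`τ_ζ` a trace, because `p` vanishes at `0` and at `ζ`, and the value depends only on the module
(`map_trace_eq_of_equiv`). In characteristic zero distinct components are therefore not isomorphic;
freeness would give the value `τ(N) = 0`. Conversely, if `p` has no non-zero root then `pt` is
constant and `x₊` is invertible, which identifies the components of degrees `1` and `0`. -/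

namespace CircleBundle

/-! ### Dilations of polynomials and q-commutation -/

section Twist

variable {K R : Type*} [Field K] [Ring R] [Algebra K R]

/-- The dilation `f(z) ↦ f(cz)`. -/
noncomputable def dilate (c : K) : K[X] →ₐ[K] K[X] := aeval (C c * X)

theorem aeval_dilate (c : K) (f : K[X]) (z : R) : aeval z (dilate c f) = aeval (c • z) f := by
  have h : (aeval z).comp (dilate c) = aeval (R := K) (c • z) := by
    ext
    simp [dilate, Algebra.smul_def]
  exact DFunLike.congr_fun h f

theorem eval_dilate (c a : K) (f : K[X]) : (dilate c f).eval a = f.eval (c * a) := by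
  simpa [coe_aeval_eq_eval] using aeval_dilate c f a

theorem dilate_dilate (c d : K) (f : K[X]) : dilate c (dilate d f) = dilate (c * d) f := by
  have h : (dilate c).comp (dilate d) = dilate (c * d) := by
    ext1
    rw [AlgHom.comp_apply, dilate, dilate, dilate, aeval_X, map_mul, aeval_X, aeval_C,
      algebraMap_eq, aeval_X, ← mul_assoc, ← C_mul, mul_comm d c]
  exact DFunLike.congr_fun h f

theorem dilate_one (f : K[X]) : dilate (1 : K) f = f := by
  simp [dilate]

theorem dilate_dilate_of_mul_eq_one {c d : K} (h : c * d = 1) (f : K[X]) :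
    dilate c (dilate d f) = f := by
  rw [dilate_dilate, h, dilate_one]

theorem mul_pow_of_mul_eq_smul {a z : R} {c : K} (h : a * z = c • (z * a)) (n : ℕ) :
    a * z ^ n = c ^ n • (z ^ n * a) := by
  have h' : SemiconjBy a z (c • z) := by
    rw [SemiconjBy, h, smul_mul_assoc]
  have := h'.pow_right n
  rwa [SemiconjBy, _root_.smul_pow, smul_mul_assoc] at this

theorem mul_aeval_of_mul_eq_smul {a z : R} {c : K} (h : a * z = c • (z * a)) (f : K[X]) :
    a * aeval z f = aeval z (dilate c f) * a := by
  rw [aeval_dilate]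
  induction f using Polynomial.induction_on' with
  | add f g hf hg => simp [mul_add, add_mul, hf, hg]
  | monomial n r =>
    rw [aeval_monomial, aeval_monomial, ← Algebra.smul_def, ← Algebra.smul_def, mul_smul_comm,
      mul_pow_of_mul_eq_smul h, _root_.smul_pow, smul_mul_assoc, smul_mul_assoc]

end Twist

/-! ### Dual families and the idempotents they define -/

section DualFamily

variable {K R : Type*} [Field K] [Ring R] [Algebra K R]

/-- A pair of finite families of degrees `-n` and `n` with `∑ aᵢ bᵢ = 1`. -/
structure IsDualFamily (𝒢 : ℤ → Submodule K R) (n : ℤ) {ι : Type*} [Fintype ι] (a b : ι → R) :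
    Prop where
  left_mem : ∀ i, a i ∈ 𝒢 (-n)
  right_mem : ∀ i, b i ∈ 𝒢 n
  sum_mul : ∑ i, a i * b i = 1

namespace IsDualFamily

variable {𝒢 : ℤ → Submodule K R} [SetLike.GradedMonoid 𝒢] {n : ℤ} {ι : Type*} [Fintype ι]
  {a b : ι → R}

/-- The map `c ↦ (c aᵢ)ᵢ`. -/
def coordinates (h : IsDualFamily 𝒢 n a b) : leftComponent 𝒢 n →ₗ[degreeZero 𝒢] ι → degreeZero 𝒢 where
  toFun c i := ⟨c * a i, by
    have := SetLike.mul_mem_graded (A := 𝒢) c.2 (h.left_mem i)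
    rwa [add_neg_cancel] at this⟩
  map_add' c d := by
    funext i
    exact Subtype.ext (add_mul _ _ _)
  map_smul' r c := by
    funext i
    exact Subtype.ext (mul_assoc _ _ _)

/-- The map `(rᵢ)ᵢ ↦ ∑ rᵢ bᵢ`. -/
def combination (h : IsDualFamily 𝒢 n a b) : (ι → degreeZero 𝒢) →ₗ[degreeZero 𝒢] leftComponent 𝒢 n :=
  ∑ i, (LinearMap.proj i).smulRight (⟨b i, h.right_mem i⟩ : leftComponent 𝒢 n)

theorem coe_combination (h : IsDualFamily 𝒢 n a b) (v : ι → degreeZero 𝒢) :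
    (h.combination v : R) = ∑ i, (v i : R) * b i := by
  simp [combination, LinearMap.sum_apply, Subalgebra.smul_def]

/-- Expand `c = c ∑ aᵢ bᵢ`. This makes the component a direct summand of a finite free module, from
which projectivity, finiteness and the idempotent all follow. -/
theorem combination_coordinates (h : IsDualFamily 𝒢 n a b) (c : leftComponent 𝒢 n) :
    h.combination (h.coordinates c) = c := by
  apply Subtype.ext
  rw [coe_combination]
  simp only [coordinates, LinearMap.coe_mk, AddHom.coe_mk, mul_assoc]
  rw [← Finset.mul_sum, h.sum_mul, mul_one]

theorem finite (h : IsDualFamily 𝒢 n a b) : Module.Finite (degreeZero 𝒢) (leftComponent 𝒢 n) :=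
  Module.Finite.of_surjective h.combination fun c => ⟨_, h.combination_coordinates c⟩

theorem projective (h : IsDualFamily 𝒢 n a b) :
    Module.Projective (degreeZero 𝒢) (leftComponent 𝒢 n) :=
  Module.Projective.of_split h.coordinates h.combination
    (LinearMap.ext h.combination_coordinates)

/-- The matrix `(bᵢ aⱼ)`. -/
def matrix (h : IsDualFamily 𝒢 n a b) : Matrix ι ι (degreeZero 𝒢) :=
  Matrix.of fun i j => ⟨b i * a j, by
    have := SetLike.mul_mem_graded (A := 𝒢) (h.right_mem i) (h.left_mem j)
    rwa [add_neg_cancel] at this⟩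

theorem coe_trace_matrix (h : IsDualFamily 𝒢 n a b) : (h.matrix.trace : R) = ∑ i, b i * a i := by
  simp [Matrix.trace, matrix]

theorem vecMulLinear_matrix (h : IsDualFamily 𝒢 n a b) :
    Matrix.vecMulLinear h.matrix = h.coordinates ∘ₗ h.combination := by
  refine LinearMap.ext fun v => funext fun j => Subtype.ext ?_
  simp [coordinates, coe_combination, Matrix.vecMul, dotProduct, matrix, Finset.sum_mul,
    mul_assoc]

theorem matrix_mul_self (h : IsDualFamily 𝒢 n a b) : h.matrix * h.matrix = h.matrix := by
  refine Matrix.ext fun i j => Subtype.ext ?_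
  simp only [Matrix.mul_apply, matrix, Matrix.of_apply]
  simp only [AddSubmonoidClass.coe_finsetSum, MulMemClass.coe_mul]
  calc ∑ x, b i * a x * (b x * a j) = b i * (∑ x, a x * b x) * a j := by
        simp only [Finset.mul_sum, Finset.sum_mul, mul_assoc]
    _ = _ := by rw [h.sum_mul, mul_one]

/-- The matrix is `coordinates` after `combination`; the latter is onto and the former injective, so
its range is a copy of the component. -/
theorem nonempty_equiv (h : IsDualFamily 𝒢 n a b) :
    Nonempty (leftComponent 𝒢 n ≃ₗ[degreeZero 𝒢] LinearMap.range (Matrix.vecMulLinear h.matrix)) := by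
  have hinj : Function.Injective h.coordinates :=
    Function.LeftInverse.injective h.combination_coordinates
  have hsurj : LinearMap.range h.combination = ⊤ :=
    LinearMap.range_eq_top.2 fun c => ⟨_, h.combination_coordinates c⟩
  refine ⟨(LinearEquiv.ofInjective _ hinj).trans (LinearEquiv.ofEq _ _ ?_)⟩
  rw [vecMulLinear_matrix, LinearMap.range_comp_of_range_eq_top _ hsurj]

end IsDualFamily

theorem isStronglyGraded_of_isDualFamily {𝒢 : ℤ → Submodule K R} [SetLike.GradedMonoid 𝒢]
    (hint : DirectSum.IsInternal 𝒢)
    (h : ∀ n : ℤ, ∃ (ι : Type) (_ : Fintype ι) (a b : ι → R), IsDualFamily 𝒢 n a b) :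
    IsStronglyGraded 𝒢 := by
  refine ⟨hint, SetLike.GradedOne.one_mem, fun m n => le_antisymm ?_ fun c hc => ?_⟩
  · exact Submodule.mul_le.2 fun x hx y hy => SetLike.mul_mem_graded hx hy
  -- With the family for `-m`, the factors `aᵢ` have degree `m`, so inserting `1 = ∑ aᵢ bᵢ` before
  -- `c` splits it as `∑ aᵢ (bᵢ c)` in the required degrees.
  · obtain ⟨ι, _, a, b, hab⟩ := h (-m)
    rw [← one_mul c, ← hab.sum_mul, Finset.sum_mul]
    refine Submodule.sum_mem _ fun i _ => ?_
    rw [mul_assoc]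
    refine Submodule.mul_mem_mul (by simpa using hab.left_mem i) ?_
    have := SetLike.mul_mem_graded (A := 𝒢) (hab.right_mem i) hc
    rwa [neg_add_cancel_left] at this

end DualFamily

/-! ### The Hattori–Stallings trace -/

section Trace

open Matrix

variable {S M : Type*} [Ring S] [AddCommGroup M] {ι κ : Type*} [Fintype ι] [Fintype κ]

theorem map_trace_mul_comm (τ : S →+ M) (hτ : ∀ a b, τ (a * b) = τ (b * a))
    (U : Matrix ι κ S) (V : Matrix κ ι S) : τ (U * V).trace = τ (V * U).trace := by
  simp only [Matrix.trace, Matrix.diag_apply, Matrix.mul_apply, map_sum]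
  rw [Finset.sum_comm]
  exact Finset.sum_congr rfl fun _ _ => Finset.sum_congr rfl fun _ _ => hτ _ _

theorem vecMul_of_mem_range {E : Matrix ι ι S} (hE : E * E = E) {v : ι → S}
    (hv : v ∈ LinearMap.range (vecMulLinear E)) : v ᵥ* E = v := by
  obtain ⟨w, rfl⟩ := hv
  simp [vecMul_vecMul, hE]

variable [DecidableEq ι]

/-- Precomposing `θ` with the map `v ↦ v ᵥ* E` extends it to a map of free modules, and such a map
has a matrix: its rows are the images of the unit vectors. -/
theorem exists_vecMul_eq {E : Matrix ι ι S} {F : Matrix κ κ S}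
    (θ : LinearMap.range (vecMulLinear E) →ₗ[S] LinearMap.range (vecMulLinear F)) :
    ∃ U : Matrix ι κ S, ∀ v : ι → S,
      v ᵥ* U = (θ ⟨v ᵥ* E, ⟨v, rfl⟩⟩ : κ → S) := by
  let g : (ι → S) →ₗ[S] κ → S :=
    (LinearMap.range (vecMulLinear F)).subtype ∘ₗ θ ∘ₗ (vecMulLinear E).rangeRestrict
  refine ⟨Matrix.of fun i => g (Pi.single i 1), fun v => ?_⟩
  have hg : (θ ⟨v ᵥ* E, ⟨v, rfl⟩⟩ : κ → S) = g v := rfl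
  rw [hg]
  conv_rhs => rw [LinearMap.pi_apply_eq_sum_univ g v]
  funext j
  simp only [vecMul, dotProduct, Matrix.of_apply, Finset.sum_apply, Pi.smul_apply, smul_eq_mul]
  refine Finset.sum_congr rfl fun i _ => ?_
  rw [show (fun j => if i = j then (1 : S) else 0) = Pi.single i 1 from
    funext fun l => by simp [Pi.single_apply, eq_comm]]

/-- The Hattori–Stallings trace only depends on the projective module. -/
theorem map_trace_eq_of_equiv [DecidableEq κ] (τ : S →+ M) (hτ : ∀ a b, τ (a * b) = τ (b * a))
    {E : Matrix ι ι S} {F : Matrix κ κ S} (hE : E * E = E) (hF : F * F = F)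
    (θ : LinearMap.range (vecMulLinear E) ≃ₗ[S] LinearMap.range (vecMulLinear F)) :
    τ E.trace = τ F.trace := by
  obtain ⟨U, hU⟩ := exists_vecMul_eq θ.toLinearMap
  obtain ⟨V, hV⟩ := exists_vecMul_eq θ.symm.toLinearMap
  -- `U` sends `v` to `θ(vE)`, which `F` fixes, so applying `V` undoes `θ` and leaves `vE`.
  have hUV : U * V = E := by
    refine Matrix.ext_of_single_vecMul fun i => ?_
    rw [← vecMul_vecMul, hU, hV]
    simp only [vecMul_of_mem_range hF (Subtype.prop _), LinearEquiv.coe_coe, Subtype.coe_eta,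
      LinearEquiv.symm_apply_apply]
  have hVU : V * U = F := by
    refine Matrix.ext_of_single_vecMul fun i => ?_
    rw [← vecMul_vecMul, hV, hU]
    simp only [vecMul_of_mem_range hE (Subtype.prop _), LinearEquiv.coe_coe, Subtype.coe_eta,
      LinearEquiv.apply_symm_apply]
  rw [← hUV, ← hVU, map_trace_mul_comm τ hτ]

end Trace

/-! ### The grading of the Veronese subalgebra -/

section Veronese

variable {K R : Type*} [Field K] [Ring R] [Algebra K R]

theorem mem_veronese {𝒜 : ℤ → Submodule K R} [SetLike.GradedMonoid 𝒜] {k : ℕ} {n : ℤ} {x : R}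
    (hx : x ∈ 𝒜 (n * k)) : x ∈ veronese 𝒜 k :=
  Submodule.mem_iSup_of_mem (p := fun n : ℤ => 𝒜 (n * k)) n hx

/-- Since `k ≠ 0`, the degrees `n * k` are distinct, so the components form a subfamily of an
independent family; they span by construction. Both facts are checked in the ambient algebra. -/
theorem isInternal_veroneseGrading {𝒜 : ℤ → Submodule K R} [SetLike.GradedMonoid 𝒜]
    (h : DirectSum.IsInternal 𝒜) {k : ℕ} (hk : k ≠ 0) :
    DirectSum.IsInternal (veroneseGrading 𝒜 k) := by
  have hinj : Function.Injective fun n : ℤ => n * (k : ℤ) :=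
    mul_left_injective₀ (by exact_mod_cast hk)
  have hmap (n : ℤ) : (veroneseGrading 𝒜 k n).map (veronese 𝒜 k).val.toLinearMap = 𝒜 (n * k) := by
    refine le_antisymm (Submodule.map_le_iff_le_comap.2 le_rfl) fun x hx => ?_
    exact ⟨⟨x, mem_veronese hx⟩, hx, rfl⟩
  have hval : Function.Injective (veronese 𝒜 k).val.toLinearMap := Subtype.val_injective
  refine DirectSum.isInternal_submodule_of_iSupIndep_of_iSup_eq_top ?_ ?_
  · refine iSupIndep_def.2 fun i => Submodule.disjoint_def.2 fun x hx hx' => hval ?_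
    have h' := Submodule.mem_map_of_mem (f := (veronese 𝒜 k).val.toLinearMap) hx'
    simp only [Submodule.map_iSup, hmap] at h'
    rw [map_zero]
    exact Submodule.disjoint_def.1
      (iSupIndep_def.1 (h.submodule_iSupIndep.comp hinj) i) _ hx h'
  · apply Submodule.map_injective_of_injective hval
    rw [Submodule.map_iSup]
    simp only [hmap]
    ext x
    simp
    rfl

end Veronese

end CircleBundle

namespace CircleBundle

/-! ### Spanning arguments for algebras given by generators -/

section Generation

variable {K R : Type*} [Field K] [Ring R] [Algebra K R]

theorem mem_of_adjoin_eq_top {s : Set R} (hs : Algebra.adjoin K s = ⊤) {N : Submodule K R}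
    (h1 : (1 : R) ∈ N) (hmul : ∀ g ∈ s, ∀ x ∈ N, x * g ∈ N) (a : R) : a ∈ N := by
  -- Stability of all of `N` under `b`, rather than membership of `b`, is what passes to products.
  have key : ∀ b ∈ Algebra.adjoin K s, ∀ x ∈ N, x * b ∈ N := by
    intro b hb
    induction hb using Algebra.adjoin_induction with
    | mem g hg => exact hmul g hg
    | algebraMap r =>
      intro x hx
      rw [← Algebra.commutes, ← Algebra.smul_def]
      exact N.smul_mem r hx
    | add b c _ _ hb hc =>
      intro x hx
      rw [mul_add]
      exact N.add_mem (hb x hx) (hc x hx)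
    | mul b c _ _ hb hc =>
      intro x hx
      rw [← mul_assoc]
      exact hc _ (hb x hx)
  simpa using key a (hs ▸ Algebra.mem_top) 1 h1

theorem aeval_mul_mem {N : Submodule K R} {w : R} (hw : ∀ x ∈ N, w * x ∈ N) (f : K[X]) {x : R}
    (hx : x ∈ N) : aeval w f * x ∈ N := by
  have hpow (n : ℕ) : w ^ n * x ∈ N := by
    induction n with
    | zero => simpa using hx
    | succ n ih =>
      rw [pow_succ', mul_assoc]
      exact hw _ ih
  induction f using Polynomial.induction_on' with
  | add f g hf hg =>
    rw [map_add, add_mul]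
    exact N.add_mem hf hg
  | monomial n r =>
    rw [aeval_monomial, ← Algebra.smul_def, smul_mul_assoc]
    exact N.smul_mem r (hpow n)

theorem adjoin_range_ringQuot {G : Type*} (r : FreeAlgebra K G → FreeAlgebra K G → Prop) :
    Algebra.adjoin K (Set.range fun g => RingQuot.mkAlgHom K r (FreeAlgebra.ι K g)) = ⊤ := by
  have h := congrArg (Subalgebra.map (RingQuot.mkAlgHom K r)) (FreeAlgebra.adjoin_range_ι K G)
  rw [AlgHom.map_adjoin, ← Set.range_comp, Algebra.map_top,
    (AlgHom.range_eq_top _).2 (RingQuot.mkAlgHom_surjective K r)] at h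
  exact h

end Generation

/-! ### The circle algebra: universal property, grading, ordered monomials -/

section Circle

variable {K : Type*} [Field K]

/-- A family satisfying the defining relations of the algebra `Circle pt qp qm`. -/
structure IsCircleFamily {R : Type*} [Ring R] [Algebra K R] (pt : K[X]) (qp qm : K)
    (g : CircleGen → R) : Prop where
  zz : g .zp * g .zm = g .zm * g .zp
  xpxm : g .xp * g .xm = aeval (g .zp * g .zm) pt
  xmxp : g .xm * g .xp = aeval ((qp * qm) • (g .zp * g .zm)) pt
  xpzp : g .xp * g .zp = qp⁻¹ • (g .zp * g .xp)
  xpzm : g .xp * g .zm = qm⁻¹ • (g .zm * g .xp)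
  xmzp : g .xm * g .zp = qp • (g .zp * g .xm)
  xmzm : g .xm * g .zm = qm • (g .zm * g .xm)

namespace Circle

variable (pt : K[X]) (qp qm : K)

theorem adjoin_range_gen : Algebra.adjoin K (Set.range (gen pt qp qm)) = ⊤ :=
  adjoin_range_ringQuot (CircleRel pt qp qm)

theorem isCircleFamily_gen : IsCircleFamily pt qp qm (gen pt qp qm) := by
  let π : FreeAlgebra K CircleGen →ₐ[K] Circle pt qp qm := RingQuot.mkAlgHom K (CircleRel pt qp qm)
  have hπ (g : CircleGen) : gen pt qp qm g = π (FreeAlgebra.ι K g) := rfl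
  have hrel {a b} (h : CircleRel pt qp qm a b) : π a = π b := RingQuot.mkAlgHom_rel K h
  constructor <;> simp only [hπ, ← map_mul, ← map_smul, aeval_algHom_apply] <;> apply hrel
  exacts [.zz, .xpxm, .xmxp, .xpzp, .xpzm, .xmzp, .xmzm]

variable {pt qp qm}

/-- The universal property of the algebra `Circle pt qp qm`. -/
noncomputable def lift {R : Type*} [Ring R] [Algebra K R] {g : CircleGen → R}
    (h : IsCircleFamily pt qp qm g) : Circle pt qp qm →ₐ[K] R :=
  RingQuot.liftAlgHom K ⟨FreeAlgebra.lift K g, by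
    rintro _ _ (_ | _ | _ | _ | _ | _ | _) <;>
      simp only [map_mul, map_smul, ← aeval_algHom_apply, FreeAlgebra.lift_ι_apply]
    exacts [h.zz, h.xpxm, h.xmxp, h.xpzp, h.xpzm, h.xmzp, h.xmzm]⟩

theorem lift_gen {R : Type*} [Ring R] [Algebra K R] {g : CircleGen → R}
    (h : IsCircleFamily pt qp qm g) (i : CircleGen) : lift h (gen pt qp qm i) = g i := by
  exact (RingQuot.liftAlgHom_mkAlgHom_apply _ _ _ _).trans (FreeAlgebra.lift_ι_apply _ _)

theorem gen_mem_grading (k : ℕ) (g : CircleGen) :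
    gen pt qp qm g ∈ grading pt qp qm k (g.degree k) :=
  Submodule.subset_span ⟨[g], by simp, by simp⟩

section Internal

variable (pt qp qm) (k : ℕ)

/-- Each relation is homogeneous: `z₊z₋`, `x₊x₋` and `x₋x₊` have degree zero, so the polynomial
relations live in exponent `0`. -/
theorem isCircleFamily_single : IsCircleFamily pt qp qm fun g =>
    (AddMonoidAlgebra.single (g.degree k) (gen pt qp qm g) :
      AddMonoidAlgebra (Circle pt qp qm) ℤ) := by
  have h := isCircleFamily_gen pt qp qm
  have h0 (a : Circle pt qp qm) (f : K[X]) :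
      aeval (AddMonoidAlgebra.single (0 : ℤ) a : AddMonoidAlgebra (Circle pt qp qm) ℤ) f =
        AddMonoidAlgebra.single 0 (aeval a f) :=
    aeval_algHom_apply (AddMonoidAlgebra.singleZeroAlgHom (R := K)) a f
  constructor <;>
    simp only [AddMonoidAlgebra.single_mul_single, AddMonoidAlgebra.smul_single, h0,
      CircleGen.degree, add_neg_cancel, h.xpxm, h.xmxp, h.xpzp, h.xpzm, h.xmzp,
      h.xmzm, add_comm]
  rw [h.zz]

/-- The coaction `a ↦ a T ^ d` for `a` of degree `d`. -/
noncomputable def coaction : Circle pt qp qm →ₐ[K] AddMonoidAlgebra (Circle pt qp qm) ℤ :=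
  lift (isCircleFamily_single pt qp qm k)

variable {pt qp qm k}

theorem coaction_of_mem {d : ℤ} {a : Circle pt qp qm} (ha : a ∈ grading pt qp qm k d) :
    coaction pt qp qm k a = AddMonoidAlgebra.single d a := by
  induction ha using Submodule.span_induction with
  | mem x hx =>
    obtain ⟨w, rfl, rfl⟩ := hx
    induction w with
    | nil => exact map_one _
    | cons g w ih =>
      simp only [List.map_cons, List.prod_cons, List.sum_cons, map_mul, ih]
      rw [coaction, lift_gen, AddMonoidAlgebra.single_mul_single]
  | zero => simp
  | add x y _ _ hx hy => rw [map_add, hx, hy, AddMonoidAlgebra.single_add]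
  | smul c x _ hx => rw [map_smul, hx, AddMonoidAlgebra.smul_single]

/-- The coefficient at exponent `i` of the coaction is the identity on the component of degree `i`
and kills every other one. The components span because right multiplication by generators preserves
their sum. -/
theorem isInternal_grading : DirectSum.IsInternal (grading pt qp qm k) := by
  refine DirectSum.isInternal_submodule_of_iSupIndep_of_iSup_eq_top ?_ ?_
  · refine iSupIndep_def.2 fun i => Submodule.disjoint_def.2 fun x hx hx' => ?_
    have hle : (⨆ j, ⨆ (_ : j ≠ i), grading pt qp qm k j) ≤ LinearMap.ker
        ((Finsupp.lapply i).comp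
          ((AddMonoidAlgebra.coeffLinearEquiv K).toLinearMap.comp (coaction pt qp qm k).toLinearMap)) := by
      refine iSup₂_le fun j hj y hy => ?_
      change (coaction pt qp qm k y).coeff i = 0
      rw [coaction_of_mem hy, AddMonoidAlgebra.coeff_single, Finsupp.single_apply, if_neg hj]
    have h : (coaction pt qp qm k x).coeff i = 0 := hle hx'
    rwa [coaction_of_mem hx, AddMonoidAlgebra.coeff_single, Finsupp.single_apply, if_pos rfl] at h
  · refine eq_top_iff.2 fun a _ => ?_
    refine mem_of_adjoin_eq_top (adjoin_range_gen pt qp qm)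
      (Submodule.mem_iSup_of_mem 0 SetLike.GradedOne.one_mem) ?_ a
    rintro _ ⟨g, rfl⟩ x hx
    induction hx using Submodule.iSup_induction' with
    | mem i x hx =>
      exact Submodule.mem_iSup_of_mem _ (SetLike.mul_mem_graded hx (gen_mem_grading k g))
    | zero => simp
    | add x y _ _ hx hy =>
      rw [add_mul]
      exact Submodule.add_mem _ hx hy

end Internal

section NormalForm

variable (pt qp qm)

/-- The span of the ordered monomials `z₊ᵃ z₋ᵇ x±ᵐ` of degree `d`. -/
noncomputable def monomialSpan (k : ℕ) (d : ℤ) : Submodule K (Circle pt qp qm) :=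
  Submodule.span K
    ({x | ∃ a b m : ℕ, (a : ℤ) - b + m * k = d ∧
        x = gen pt qp qm .zp ^ a * gen pt qp qm .zm ^ b * gen pt qp qm .xp ^ m} ∪
      {x | ∃ a b m : ℕ, (a : ℤ) - b - m * k = d ∧
        x = gen pt qp qm .zp ^ a * gen pt qp qm .zm ^ b * gen pt qp qm .xm ^ m})

variable {pt qp qm} {k : ℕ}

theorem zp_mul_mem {d : ℤ} {x : Circle pt qp qm} (hx : x ∈ monomialSpan pt qp qm k d) :
    gen pt qp qm .zp * x ∈ monomialSpan pt qp qm k (d + 1) := by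
  induction hx using Submodule.span_induction with
  | mem x hx =>
    obtain ⟨a, b, m, hd, rfl⟩ | ⟨a, b, m, hd, rfl⟩ := hx
    · refine Submodule.subset_span (.inl ⟨a + 1, b, m, ?_, ?_⟩)
      · push_cast
        linarith
      · simp only [pow_succ', mul_assoc]
    · refine Submodule.subset_span (.inr ⟨a + 1, b, m, ?_, ?_⟩)
      · push_cast
        linarith
      · simp only [pow_succ', mul_assoc]
  | zero => simp
  | add x y _ _ hx hy => simpa [mul_add] using Submodule.add_mem _ hx hy
  | smul c x _ hx => simpa using Submodule.smul_mem _ c hx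

theorem zm_mul_mem {d : ℤ} {x : Circle pt qp qm} (hx : x ∈ monomialSpan pt qp qm k d) :
    gen pt qp qm .zm * x ∈ monomialSpan pt qp qm k (d - 1) := by
  have hc (a : ℕ) : gen pt qp qm .zm * gen pt qp qm .zp ^ a =
      gen pt qp qm .zp ^ a * gen pt qp qm .zm :=
    (Commute.pow_right (isCircleFamily_gen pt qp qm).zz.symm a)
  induction hx using Submodule.span_induction with
  | mem x hx =>
    obtain ⟨a, b, m, hd, rfl⟩ | ⟨a, b, m, hd, rfl⟩ := hx
    · refine Submodule.subset_span (.inl ⟨a, b + 1, m, ?_, ?_⟩)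
      · push_cast
        linarith
      · rw [← mul_assoc, ← mul_assoc, hc, pow_succ', ← mul_assoc]
    · refine Submodule.subset_span (.inr ⟨a, b + 1, m, ?_, ?_⟩)
      · push_cast
        linarith
      · rw [← mul_assoc, ← mul_assoc, hc, pow_succ', ← mul_assoc]
  | zero => simp
  | add x y _ _ hx hy => simpa [mul_add] using Submodule.add_mem _ hx hy
  | smul c x _ hx => simpa using Submodule.smul_mem _ c hx

theorem aeval_mul_mem_monomialSpan {d : ℤ} {x : Circle pt qp qm}
    (hx : x ∈ monomialSpan pt qp qm k d) (f : K[X]) :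
    aeval (gen pt qp qm .zp * gen pt qp qm .zm) f * x ∈ monomialSpan pt qp qm k d := by
  refine aeval_mul_mem (fun y hy => ?_) f hx
  simpa [mul_assoc] using zp_mul_mem (zm_mul_mem hy)

theorem commute_aeval (a b : ℕ) (f : K[X]) :
    Commute (gen pt qp qm .zp ^ a * gen pt qp qm .zm ^ b)
      (aeval (gen pt qp qm .zp * gen pt qp qm .zm) f) := by
  have h : Commute (gen pt qp qm .zp) (gen pt qp qm .zm) := (isCircleFamily_gen pt qp qm).zz
  have h1 : Commute (gen pt qp qm .zp ^ a * gen pt qp qm .zm ^ b)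
      (gen pt qp qm .zp * gen pt qp qm .zm) :=
    (((Commute.refl _).mul_right h).pow_left a).mul_left
      ((h.symm.mul_right (Commute.refl _)).pow_left b)
  have h2 := mul_aeval_of_mul_eq_smul (c := (1 : K)) (h1.eq.trans (one_smul _ _).symm) f
  rwa [dilate_one] at h2

theorem mul_monomial {x : Circle pt qp qm} {r s : K}
    (hr : x * gen pt qp qm .zp = r • (gen pt qp qm .zp * x))
    (hs : x * gen pt qp qm .zm = s • (gen pt qp qm .zm * x)) (a b : ℕ) :
    x * (gen pt qp qm .zp ^ a * gen pt qp qm .zm ^ b) =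
      (r ^ a * s ^ b) • (gen pt qp qm .zp ^ a * gen pt qp qm .zm ^ b * x) := by
  rw [← mul_assoc, mul_pow_of_mul_eq_smul hr, smul_mul_assoc, mul_assoc,
    mul_pow_of_mul_eq_smul hs, mul_smul_comm, smul_smul, mul_assoc]

/-- After `x` has crossed `z₊` and `z₋`, one pair `x x'` contracts to a polynomial in `z₊z₋`, which
commutes with both and can be moved to the left. -/
theorem mul_monomial_mul_pow {x x' : Circle pt qp qm} {r s : K} {f : K[X]}
    (hr : x * gen pt qp qm .zp = r • (gen pt qp qm .zp * x))
    (hs : x * gen pt qp qm .zm = s • (gen pt qp qm .zm * x))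
    (hx : x * x' = aeval (gen pt qp qm .zp * gen pt qp qm .zm) f) (a b m : ℕ) :
    x * (gen pt qp qm .zp ^ a * gen pt qp qm .zm ^ b * x' ^ (m + 1)) =
      (r ^ a * s ^ b) • (aeval (gen pt qp qm .zp * gen pt qp qm .zm) f *
        (gen pt qp qm .zp ^ a * gen pt qp qm .zm ^ b * x' ^ m)) := by
  rw [← mul_assoc, mul_monomial hr hs, smul_mul_assoc, mul_assoc, pow_succ', ← mul_assoc x,
    hx, ← mul_assoc, (commute_aeval a b f).eq, mul_assoc]

theorem xp_mul_mem {d : ℤ} {x : Circle pt qp qm} (hx : x ∈ monomialSpan pt qp qm k d) :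
    gen pt qp qm .xp * x ∈ monomialSpan pt qp qm k (d + k) := by
  have h := isCircleFamily_gen pt qp qm
  induction hx using Submodule.span_induction with
  | mem x hx =>
    obtain ⟨a, b, m, hd, rfl⟩ | ⟨a, b, _ | m, hd, rfl⟩ := hx
    · rw [← mul_assoc, mul_monomial h.xpzp h.xpzm, smul_mul_assoc, mul_assoc, ← pow_succ']
      refine Submodule.smul_mem _ _ (Submodule.subset_span (.inl ⟨a, b, m + 1, ?_, rfl⟩))
      push_cast
      linarith
    · rw [← mul_assoc, mul_monomial h.xpzp h.xpzm, smul_mul_assoc, mul_assoc, pow_zero, mul_one,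
        ← pow_one (gen pt qp qm .xp)]
      refine Submodule.smul_mem _ _ (Submodule.subset_span (.inl ⟨a, b, 1, ?_, rfl⟩))
      push_cast at hd ⊢
      linarith
    · rw [mul_monomial_mul_pow h.xpzp h.xpzm h.xpxm]
      refine Submodule.smul_mem _ _ (aeval_mul_mem_monomialSpan (Submodule.subset_span
        (.inr ⟨a, b, m, ?_, rfl⟩)) _)
      push_cast at hd ⊢
      linarith
  | zero => simp
  | add x y _ _ hx hy => simpa [mul_add] using Submodule.add_mem _ hx hy
  | smul c x _ hx => simpa using Submodule.smul_mem _ c hx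

theorem xm_mul_mem {d : ℤ} {x : Circle pt qp qm} (hx : x ∈ monomialSpan pt qp qm k d) :
    gen pt qp qm .xm * x ∈ monomialSpan pt qp qm k (d - k) := by
  have h := isCircleFamily_gen pt qp qm
  have hxmxp := h.xmxp
  rw [← aeval_dilate] at hxmxp
  induction hx using Submodule.span_induction with
  | mem x hx =>
    obtain ⟨a, b, _ | m, hd, rfl⟩ | ⟨a, b, m, hd, rfl⟩ := hx
    · rw [← mul_assoc, mul_monomial h.xmzp h.xmzm, smul_mul_assoc, mul_assoc, pow_zero, mul_one,
        ← pow_one (gen pt qp qm .xm)]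
      refine Submodule.smul_mem _ _ (Submodule.subset_span (.inr ⟨a, b, 1, ?_, rfl⟩))
      push_cast at hd ⊢
      linarith
    · rw [mul_monomial_mul_pow h.xmzp h.xmzm hxmxp]
      refine Submodule.smul_mem _ _ (aeval_mul_mem_monomialSpan (Submodule.subset_span
        (.inl ⟨a, b, m, ?_, rfl⟩)) _)
      push_cast at hd ⊢
      linarith
    · rw [← mul_assoc, mul_monomial h.xmzp h.xmzm, smul_mul_assoc, mul_assoc, ← pow_succ']
      refine Submodule.smul_mem _ _ (Submodule.subset_span (.inr ⟨a, b, m + 1, ?_, rfl⟩))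
      push_cast
      linarith
  | zero => simp
  | add x y _ _ hx hy => simpa [mul_add] using Submodule.add_mem _ hx hy
  | smul c x _ hx => simpa using Submodule.smul_mem _ c hx

/-- A word is built by adding letters on the left, and each letter shifts the span by its own
degree. Keeping track of the degree lets the degree-zero monomials be isolated. -/
theorem grading_le_monomialSpan (d : ℤ) :
    grading pt qp qm k d ≤ monomialSpan pt qp qm k d := by
  refine Submodule.span_le.2 ?_
  rintro _ ⟨w, rfl, rfl⟩
  induction w with
  | nil => exact Submodule.subset_span (.inl ⟨0, 0, 0, by simp, by simp⟩)
  | cons g w ih =>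
    simp only [List.map_cons, List.prod_cons, List.sum_cons, add_comm (g.degree k)]
    cases g
    exacts [zp_mul_mem ih, zm_mul_mem ih, xp_mul_mem ih, xm_mul_mem ih]

/-- In degree zero the exponents of `z₊` and `z₋` differ by `m * k`. After a power of `z₊z₋` is
extracted, what remains is `z₊^(mk) x₋ᵐ` or `z₋^(mk) x₊ᵐ`, an invertible scalar times an `m`-th
power of one of the two given elements. -/
theorem mem_of_mem_grading_zero (hqp : qp ≠ 0) (hqm : qm ≠ 0) {S : Subalgebra K (Circle pt qp qm)}
    (hx : gen pt qp qm .xm * gen pt qp qm .zp ^ k ∈ S)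
    (hy : gen pt qp qm .zm ^ k * gen pt qp qm .xp ∈ S)
    (hz : gen pt qp qm .zp * gen pt qp qm .zm ∈ S) {a : Circle pt qp qm}
    (ha : a ∈ grading pt qp qm k 0) : a ∈ S := by
  have h := isCircleFamily_gen pt qp qm
  have hzz : Commute (gen pt qp qm .zp) (gen pt qp qm .zm) := h.zz
  have hxm (m : ℕ) : gen pt qp qm .zp ^ (m * k) * gen pt qp qm .xm ^ m ∈ S := by
    induction m with
    | zero => simp
    | succ m ih =>
      have e : gen pt qp qm .xm * gen pt qp qm .zp ^ k *
          (gen pt qp qm .zp ^ (m * k) * gen pt qp qm .xm ^ m) =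
          qp ^ ((m + 1) * k) •
            (gen pt qp qm .zp ^ ((m + 1) * k) * gen pt qp qm .xm ^ (m + 1)) := by
        rw [mul_assoc, ← mul_assoc _ _ (_ ^ m), ← pow_add, ← mul_assoc,
          mul_pow_of_mul_eq_smul h.xmzp, smul_mul_assoc, mul_assoc, ← pow_succ',
          show k + m * k = (m + 1) * k by ring]
      have hmem := S.smul_mem (S.mul_mem hx ih) (qp ^ ((m + 1) * k))⁻¹
      rwa [e, inv_smul_smul₀ (pow_ne_zero _ hqp)] at hmem
  have hxp (m : ℕ) : gen pt qp qm .zm ^ (m * k) * gen pt qp qm .xp ^ m ∈ S := by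
    induction m with
    | zero => simp
    | succ m ih =>
      have e : gen pt qp qm .zm ^ k * gen pt qp qm .xp *
          (gen pt qp qm .zm ^ (m * k) * gen pt qp qm .xp ^ m) =
          qm⁻¹ ^ (m * k) •
            (gen pt qp qm .zm ^ ((m + 1) * k) * gen pt qp qm .xp ^ (m + 1)) := by
        rw [mul_assoc, ← mul_assoc _ _ (_ ^ m), mul_pow_of_mul_eq_smul h.xpzm, smul_mul_assoc,
          mul_smul_comm, mul_assoc, ← pow_succ', ← mul_assoc, ← pow_add,
          show k + m * k = (m + 1) * k by ring]
      have hmem := S.smul_mem (S.mul_mem hy ih) (qm⁻¹ ^ (m * k))⁻¹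
      rwa [e, inv_smul_smul₀ (pow_ne_zero _ (inv_ne_zero hqm))] at hmem
  have hle : monomialSpan pt qp qm k 0 ≤ Subalgebra.toSubmodule S := by
    refine Submodule.span_le.2 ?_
    rintro _ (⟨a, b, m, hd, rfl⟩ | ⟨a, b, m, hd, rfl⟩)
    · obtain rfl : b = a + m * k := by
        zify
        linarith
      rw [pow_add, ← mul_assoc, ← hzz.mul_pow, mul_assoc]
      exact S.mul_mem (S.pow_mem hz a) (hxp m)
    · obtain rfl : a = b + m * k := by
        zify
        linarith
      rw [pow_add, mul_assoc (_ ^ b), (hzz.pow_pow (m * k) b).eq, ← mul_assoc, ← hzz.mul_pow,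
        mul_assoc]
      exact S.mul_mem (S.pow_mem hz b) (hxm m)
  exact hle (grading_le_monomialSpan 0 ha)

end NormalForm

end Circle

end Circle

end CircleBundle

namespace CircleBundle

/-! ### Products of dual families -/

section DualFamily

variable {K R : Type*} [Field K] [Ring R] [Algebra K R]

theorem IsDualFamily.mul {𝒢 : ℤ → Submodule K R} [SetLike.GradedMul 𝒢] {m n : ℤ} {ι κ : Type*}
    [Fintype ι] [Fintype κ] {a b : ι → R} {α β : κ → R} (h : IsDualFamily 𝒢 n a b)
    (h' : IsDualFamily 𝒢 m α β) :
    IsDualFamily 𝒢 (n + m) (fun i : ι × κ => a i.1 * α i.2) (fun i => β i.2 * b i.1) where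
  left_mem i := by
    rw [neg_add]
    exact SetLike.mul_mem_graded (h.left_mem i.1) (h'.left_mem i.2)
  right_mem i := by
    rw [add_comm]
    exact SetLike.mul_mem_graded (h'.right_mem i.2) (h.right_mem i.1)
  sum_mul := by
    calc ∑ i : ι × κ, a i.1 * α i.2 * (β i.2 * b i.1)
        = ∑ i, a i * (∑ s, α s * β s) * b i := by
          rw [Fintype.sum_prod_type]
          simp only [Finset.mul_sum, Finset.sum_mul, mul_assoc]
      _ = 1 := by simp only [h'.sum_mul, mul_one, h.sum_mul]

/-- The trace of the idempotent of a product family is the old trace sandwiched by the new family;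
this drives the recursion for the traces. -/
theorem sum_mul_mul_mul_prod {ι κ : Type*} [Fintype ι] [Fintype κ] (a b : ι → R) (α β : κ → R) :
    ∑ i : ι × κ, β i.2 * b i.1 * (a i.1 * α i.2) = ∑ s, β s * (∑ i, b i * a i) * α s := by
  rw [Fintype.sum_prod_type, Finset.sum_comm]
  simp only [Finset.mul_sum, Finset.sum_mul, mul_assoc]

theorem IsDualFamily.veronese {𝒜 : ℤ → Submodule K R} [SetLike.GradedMonoid 𝒜] {k : ℕ} {n : ℤ}
    {ι : Type*} [Fintype ι] {a b : ι → R} (h : IsDualFamily (fun n : ℤ => 𝒜 (n * k)) n a b) :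
    IsDualFamily (veroneseGrading 𝒜 k) n
      (fun i => (⟨a i, mem_veronese (h.left_mem i)⟩ : CircleBundle.veronese 𝒜 k))
      (fun i => ⟨b i, mem_veronese (h.right_mem i)⟩) where
  left_mem := h.left_mem
  right_mem := h.right_mem
  sum_mul := Subtype.ext (by simpa using h.sum_mul)

end DualFamily

/-! ### Bézout identities and traces in the circle algebra -/

namespace Circle

variable {K : Type*} [Field K] {pt : K[X]} {qp qm : K} {k : ℕ}

theorem pow_gen_mem_grading (m : ℕ) (g : CircleGen) :
    gen pt qp qm g ^ m ∈ grading pt qp qm k (m * g.degree k) := by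
  have := SetLike.pow_mem_graded m (gen_mem_grading (pt := pt) (qp := qp) (qm := qm) k g)
  rwa [nsmul_eq_mul] at this

theorem aeval_mem_grading (f : K[X]) :
    aeval (gen pt qp qm .zp * gen pt qp qm .zm) f ∈ grading pt qp qm k 0 := by
  have h1 : (1 : Circle pt qp qm) ∈ grading pt qp qm k 0 := SetLike.GradedOne.one_mem
  rw [← mul_one (aeval _ f)]
  refine aeval_mul_mem (fun x hx => ?_) f h1
  have hz := SetLike.mul_mem_graded
    (gen_mem_grading (pt := pt) (qp := qp) (qm := qm) k .zp) (gen_mem_grading k .zm)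
  have := SetLike.mul_mem_graded hz hx
  simpa [CircleGen.degree] using this

theorem aeval_mul_mem_grading {d : ℤ} {x : Circle pt qp qm} (hx : x ∈ grading pt qp qm k d)
    (f : K[X]) : aeval (gen pt qp qm .zp * gen pt qp qm .zm) f * x ∈ grading pt qp qm k d := by
  have := SetLike.mul_mem_graded (aeval_mem_grading (k := k) f) hx
  rwa [zero_add] at this

theorem commute_zp_pow_aeval (n : ℕ) (f : K[X]) :
    Commute (gen pt qp qm .zp ^ n) (aeval (gen pt qp qm .zp * gen pt qp qm .zm) f) := by
  simpa using commute_aeval (pt := pt) (qp := qp) (qm := qm) n 0 f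

theorem commute_zm_pow_aeval (n : ℕ) (f : K[X]) :
    Commute (gen pt qp qm .zm ^ n) (aeval (gen pt qp qm .zp * gen pt qp qm .zm) f) := by
  simpa using commute_aeval (pt := pt) (qp := qp) (qm := qm) 0 n f

theorem xp_mul_aeval (f : K[X]) :
    gen pt qp qm .xp * aeval (gen pt qp qm .zp * gen pt qp qm .zm) f =
      aeval (gen pt qp qm .zp * gen pt qp qm .zm) (dilate (qp * qm)⁻¹ f) * gen pt qp qm .xp := by
  have h := isCircleFamily_gen pt qp qm
  refine mul_aeval_of_mul_eq_smul ?_ f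
  simpa [mul_comm qm⁻¹] using mul_monomial h.xpzp h.xpzm 1 1

theorem xm_mul_aeval (f : K[X]) :
    gen pt qp qm .xm * aeval (gen pt qp qm .zp * gen pt qp qm .zm) f =
      aeval (gen pt qp qm .zp * gen pt qp qm .zm) (dilate (qp * qm) f) * gen pt qp qm .xm := by
  have h := isCircleFamily_gen pt qp qm
  refine mul_aeval_of_mul_eq_smul ?_ f
  simpa using mul_monomial h.xmzp h.xmzm 1 1

theorem zp_pow_mul_zm_pow (n : ℕ) : gen pt qp qm .zp ^ n * gen pt qp qm .zm ^ n =
    aeval (gen pt qp qm .zp * gen pt qp qm .zm) (X ^ n : K[X]) := by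
  have h : Commute (gen pt qp qm .zp) (gen pt qp qm .zm) := (isCircleFamily_gen pt qp qm).zz
  rw [map_pow, aeval_X, h.mul_pow]

theorem zm_pow_mul_zp_pow (n : ℕ) : gen pt qp qm .zm ^ n * gen pt qp qm .zp ^ n =
    aeval (gen pt qp qm .zp * gen pt qp qm .zm) (X ^ n : K[X]) := by
  have h : Commute (gen pt qp qm .zp) (gen pt qp qm .zm) := (isCircleFamily_gen pt qp qm).zz
  rw [← zp_pow_mul_zm_pow, (h.pow_pow n n).eq]

theorem zp_pow_mul_aeval_mul (n : ℕ) (f g : K[X]) :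
    gen pt qp qm .zp ^ n * aeval (gen pt qp qm .zp * gen pt qp qm .zm) f *
      (aeval (gen pt qp qm .zp * gen pt qp qm .zm) g * gen pt qp qm .zm ^ n) =
    aeval (gen pt qp qm .zp * gen pt qp qm .zm) (f * (g * X ^ n)) := by
  rw [← mul_assoc, mul_assoc (_ ^ n), ← map_mul, (commute_zp_pow_aeval n _).eq, mul_assoc,
    zp_pow_mul_zm_pow, ← map_mul, mul_assoc f g]

theorem zm_pow_mul_aeval_mul (n : ℕ) (f g : K[X]) :
    gen pt qp qm .zm ^ n * aeval (gen pt qp qm .zp * gen pt qp qm .zm) f *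
      (aeval (gen pt qp qm .zp * gen pt qp qm .zm) g * gen pt qp qm .zp ^ n) =
    aeval (gen pt qp qm .zp * gen pt qp qm .zm) (f * (g * X ^ n)) := by
  rw [← mul_assoc, mul_assoc (_ ^ n), ← map_mul, (commute_zm_pow_aeval n _).eq, mul_assoc,
    zm_pow_mul_zp_pow, ← map_mul, mul_assoc f g]

theorem isCoprime_X_pow {f : K[X]} (hf : f.eval 0 ≠ 0) (n : ℕ) : IsCoprime f (X ^ n) := by
  refine IsCoprime.pow_right ?_
  rw [isCoprime_comm, irreducible_X.coprime_iff_not_dvd, X_dvd_iff, coeff_zero_eq_eval_zero]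
  exact hf

instance : SetLike.GradedMul fun n : ℤ => grading pt qp qm k (n * k) where
  mul_mem {i j} x y hx hy := by
    rw [add_mul]
    exact SetLike.mul_mem_graded hx hy

/-- With `w = z₊z₋`, one has `x₋x₊ = pt(qw)` and `z₋ᵏz₊ᵏ = wᵏ`, so a Bézout identity for these two
polynomials is exactly a dual family. The last clause allows an arbitrary `f` because `f` will be
the trace of the previous family. -/
theorem exists_isDualFamily_one (hpt : pt.eval 0 ≠ 0) :
    ∃ (α β : Fin 2 → Circle pt qp qm) (u v : K[X]),
      IsDualFamily (fun n : ℤ => grading pt qp qm k (n * k)) 1 α β ∧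
      u * dilate (qp * qm) pt + v * X ^ k = 1 ∧
      ∀ f, ∑ s, β s * aeval (gen pt qp qm .zp * gen pt qp qm .zm) f * α s =
        aeval (gen pt qp qm .zp * gen pt qp qm .zm)
          (dilate (qp * qm)⁻¹ (f * u) * pt + f * (v * X ^ k)) := by
  have h := isCircleFamily_gen pt qp qm
  obtain ⟨u, v, huv⟩ := isCoprime_X_pow (f := dilate (qp * qm) pt) (by simpa [eval_dilate] using hpt) k
  refine ⟨![aeval (gen pt qp qm .zp * gen pt qp qm .zm) u * gen pt qp qm .xm,
      aeval (gen pt qp qm .zp * gen pt qp qm .zm) v * gen pt qp qm .zm ^ k],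
    ![gen pt qp qm .xp, gen pt qp qm .zp ^ k], u, v, ⟨?_, ?_, ?_⟩, huv, fun f => ?_⟩
  · refine Fin.forall_fin_two.2 ⟨aeval_mul_mem_grading ?_ u, aeval_mul_mem_grading ?_ v⟩
    · simpa [CircleGen.degree] using gen_mem_grading (pt := pt) (qp := qp) (qm := qm) k .xm
    · simpa [CircleGen.degree] using pow_gen_mem_grading (pt := pt) (qp := qp) (qm := qm) (k := k) k .zm
  · refine Fin.forall_fin_two.2 ⟨?_, ?_⟩
    · simpa [CircleGen.degree] using gen_mem_grading (pt := pt) (qp := qp) (qm := qm) k .xp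
    · simpa [CircleGen.degree] using pow_gen_mem_grading (pt := pt) (qp := qp) (qm := qm) (k := k) k .zp
  · rw [Fin.sum_univ_two]
    simp only [Matrix.cons_val_zero, Matrix.cons_val_one, mul_assoc]
    rw [h.xmxp, ← aeval_dilate, zm_pow_mul_zp_pow, ← map_mul, ← map_mul, ← map_add, huv, map_one]
  · rw [Fin.sum_univ_two]
    simp only [Matrix.cons_val_zero, Matrix.cons_val_one]
    rw [← mul_assoc, mul_assoc (gen pt qp qm .xp), ← map_mul, xp_mul_aeval, mul_assoc, h.xpxm,
      ← map_mul, zp_pow_mul_aeval_mul, ← map_add]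

/-- Here the products are `x₊x₋ = pt(w)` and `z₊ᵏz₋ᵏ = wᵏ`, so the Bézout identity involves `pt`
undilated, and the dilation appears in the trace instead. -/
theorem exists_isDualFamily_neg_one (hpt : pt.eval 0 ≠ 0) :
    ∃ (α β : Fin 2 → Circle pt qp qm) (u v : K[X]),
      IsDualFamily (fun n : ℤ => grading pt qp qm k (n * k)) (-1) α β ∧
      u * pt + v * X ^ k = 1 ∧
      ∀ f, ∑ s, β s * aeval (gen pt qp qm .zp * gen pt qp qm .zm) f * α s =
        aeval (gen pt qp qm .zp * gen pt qp qm .zm)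
          (dilate (qp * qm) (f * u * pt) + f * (v * X ^ k)) := by
  have h := isCircleFamily_gen pt qp qm
  obtain ⟨u, v, huv⟩ := isCoprime_X_pow hpt k
  refine ⟨![aeval (gen pt qp qm .zp * gen pt qp qm .zm) u * gen pt qp qm .xp,
      aeval (gen pt qp qm .zp * gen pt qp qm .zm) v * gen pt qp qm .zp ^ k],
    ![gen pt qp qm .xm, gen pt qp qm .zm ^ k], u, v, ⟨?_, ?_, ?_⟩, huv, fun f => ?_⟩
  · refine Fin.forall_fin_two.2 ⟨aeval_mul_mem_grading ?_ u, aeval_mul_mem_grading ?_ v⟩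
    · simpa [CircleGen.degree] using gen_mem_grading (pt := pt) (qp := qp) (qm := qm) k .xp
    · simpa [CircleGen.degree] using pow_gen_mem_grading (pt := pt) (qp := qp) (qm := qm) (k := k) k .zp
  · refine Fin.forall_fin_two.2 ⟨?_, ?_⟩
    · simpa [CircleGen.degree] using gen_mem_grading (pt := pt) (qp := qp) (qm := qm) k .xm
    · simpa [CircleGen.degree] using pow_gen_mem_grading (pt := pt) (qp := qp) (qm := qm) (k := k) k .zm
  · rw [Fin.sum_univ_two]
    simp only [Matrix.cons_val_zero, Matrix.cons_val_one, mul_assoc]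
    rw [h.xpxm, zp_pow_mul_zm_pow, ← map_mul, ← map_mul, ← map_add, huv, map_one]
  · rw [Fin.sum_univ_two]
    simp only [Matrix.cons_val_zero, Matrix.cons_val_one]
    rw [← mul_assoc, mul_assoc (gen pt qp qm .xm), ← map_mul, xm_mul_aeval, mul_assoc, h.xmxp,
      ← aeval_dilate, ← map_mul, ← map_mul, zm_pow_mul_aeval_mul, ← map_add]

/-- At each step the Bézout identity splits `f` into a multiple of `pt` (or of its dilation) and a
multiple of `X ^ k`, and only the former is dilated. Its value at `0` is `1`, so `f(0) = 1` persists
and `L f` changes by exactly `c`. Taking `L = 0`, `c = 0` gives bare existence; taking `τ_ζ` on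
polynomials, `c = 1`, gives the trace. -/
theorem exists_isDualFamily (hq : qp * qm ≠ 0) (hpt : pt.eval 0 ≠ 0) (hk : k ≠ 0)
    {M : Type*} [AddCommGroup M] [Module K M] (L : K[X] →ₗ[K] M) (c : M)
    (hL : ∀ g, L (dilate (qp * qm) (g * pt)) = L (g * pt) + (g * pt).eval 0 • c) (n : ℤ) :
    ∃ (ι : Type) (_ : Fintype ι) (a b : ι → Circle pt qp qm) (f : K[X]),
      IsDualFamily (fun n : ℤ => grading pt qp qm k (n * k)) n a b ∧
      ∑ i, b i * a i = aeval (gen pt qp qm .zp * gen pt qp qm .zm) f ∧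
      f.eval 0 = 1 ∧ L f = L 1 - n • c := by
  induction n using Int.induction_on with
  | zero =>
    have h1 : (1 : Circle pt qp qm) ∈ grading pt qp qm k 0 := SetLike.GradedOne.one_mem
    exact ⟨Unit, inferInstance, 1, 1, 1, ⟨fun _ => by simpa using h1, fun _ => by simpa using h1,
      by simp⟩, by simp, by simp, by simp⟩
  | succ n ih =>
    obtain ⟨ι, _, a, b, f, hab, hba, hf, hLf⟩ := ih
    obtain ⟨α, β, u, v, h, huv, hβα⟩ := exists_isDualFamily_one (k := k) (qp := qp) (qm := qm) hpt
    have huv0 : u.eval 0 * pt.eval 0 = 1 := by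
      simpa [hk, eval_dilate] using congrArg (eval 0) huv
    have h0 : (dilate (qp * qm)⁻¹ (f * u) * pt).eval 0 = 1 := by
      simp [eval_dilate, hf, huv0]
    refine ⟨ι × Fin 2, inferInstance, _, _,
      dilate (qp * qm)⁻¹ (f * u) * pt + f * (v * X ^ k), hab.mul h, ?_, ?_, ?_⟩
    · rw [sum_mul_mul_mul_prod, hba, hβα]
    · rw [eval_add, h0]
      simp [hk]
    -- Dilating the first summand of the new trace back gives `f * u * dilate q pt`, which adds up
    -- with `f * v * X ^ k` to `f`; the price is one `c`.
    · have := hL (dilate (qp * qm)⁻¹ (f * u))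
      rw [h0, one_smul, map_mul, dilate_dilate_of_mul_eq_one (mul_inv_cancel₀ hq)] at this
      rw [map_add, ← sub_eq_of_eq_add this, sub_add_eq_add_sub, ← map_add,
        show f * u * dilate (qp * qm) pt + f * (v * X ^ k) = f by linear_combination f * huv,
        hLf, add_smul, one_smul, sub_sub]
  | pred n ih =>
    obtain ⟨ι, _, a, b, f, hab, hba, hf, hLf⟩ := ih
    obtain ⟨α, β, u, v, h, huv, hβα⟩ := exists_isDualFamily_neg_one (qp := qp) (qm := qm) (k := k) hpt
    have huv0 : u.eval 0 * pt.eval 0 = 1 := by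
      simpa [hk] using congrArg (eval 0) huv
    have h0 : (f * u * pt).eval 0 = 1 := by
      simp [hf, huv0]
    refine ⟨ι × Fin 2, inferInstance, _, _,
      dilate (qp * qm) (f * u * pt) + f * (v * X ^ k), hab.mul h, ?_, ?_, ?_⟩
    · rw [sum_mul_mul_mul_prod, hba, hβα]
    · rw [eval_add, eval_dilate, mul_zero, h0]
      simp [hk]
    · rw [map_add, hL, h0, one_smul, add_right_comm, ← map_add,
        show f * u * pt + f * (v * X ^ k) = f by linear_combination f * huv,
        hLf, sub_smul, one_smul, ← sub_add]

end Circle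

end CircleBundle

namespace CircleBundle

/-! ### The Weyl algebra is spanned by `xⁿ f(z)` and `yⁿ f(z)` -/

section Weyl

variable {K : Type*} [Field K]

/-- A family satisfying the defining relations of the algebra `Weyl p q 0`. -/
structure IsWeylFamily {R : Type*} [Ring R] [Algebra K R] (p : K[X]) (q : K)
    (g : WeylGen → R) : Prop where
  xy : g .x * g .y = aeval (g .z) (dilate q p)
  yx : g .y * g .x = aeval (g .z) p
  xz : g .x * g .z = q • (g .z * g .x)
  yz : g .y * g .z = q⁻¹ • (g .z * g .y)

namespace Weyl

variable (p : K[X]) (q : K)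

theorem adjoin_range_gen : Algebra.adjoin K (Set.range (gen p q 0)) = ⊤ :=
  adjoin_range_ringQuot (WeylRel p q 0)

theorem isWeylFamily_gen : IsWeylFamily p q (gen p q 0) := by
  let π : FreeAlgebra K WeylGen →ₐ[K] Weyl p q 0 := RingQuot.mkAlgHom K (WeylRel p q 0)
  have hπ (g : WeylGen) : gen p q 0 g = π (FreeAlgebra.ι K g) := rfl
  have hrel {a b} (h : WeylRel p q 0 a b) : π a = π b := RingQuot.mkAlgHom_rel K h
  constructor
  · have h := hrel .xy
    rw [map_zero, add_zero] at h
    rw [hπ, hπ, hπ, aeval_dilate, ← map_smul, aeval_algHom_apply, ← map_mul, h]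
  · simpa [hπ, aeval_algHom_apply] using hrel .yx
  · simpa [hπ] using hrel .xz
  · simpa [hπ] using hrel .yz

variable {p q}

/-- The universal property of the algebra `Weyl p q 0`. -/
noncomputable def lift {R : Type*} [Ring R] [Algebra K R] {g : WeylGen → R}
    (h : IsWeylFamily p q g) : Weyl p q 0 →ₐ[K] R :=
  RingQuot.liftAlgHom K ⟨FreeAlgebra.lift K g, by
    rintro _ _ (_ | _ | _ | _)
    · simpa [← aeval_algHom_apply, aeval_dilate] using h.xy
    · simpa [← aeval_algHom_apply] using h.yx
    · simpa using h.xz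
    · simpa using h.yz⟩

theorem lift_gen {R : Type*} [Ring R] [Algebra K R] {g : WeylGen → R}
    (h : IsWeylFamily p q g) (i : WeylGen) : lift h (gen p q 0 i) = g i := by
  exact (RingQuot.liftAlgHom_mkAlgHom_apply _ _ _ _).trans (FreeAlgebra.lift_ι_apply _ _)

variable (p q)

/-- The polynomials in `z`. -/
noncomputable def poly : K[X] →ₐ[K] Weyl p q 0 := aeval (gen p q 0 .z)

/-- The element `x ^ n` for `n ≥ 0` and `y ^ (-n)` for `n < 0`. -/
noncomputable def power : ℤ → Weyl p q 0
  | .ofNat m => gen p q 0 .x ^ m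
  | .negSucc m => gen p q 0 .y ^ (m + 1)

theorem power_natCast (m : ℕ) : power p q m = gen p q 0 .x ^ m := rfl

theorem power_zero : power p q 0 = 1 := pow_zero _

theorem power_neg_natCast (m : ℕ) : power p q (-m) = gen p q 0 .y ^ m := by
  cases m with
  | zero => simp [power_zero]
  | succ m => rfl

variable {p q}

theorem x_mul_poly (f : K[X]) :
    gen p q 0 .x * poly p q f = poly p q (dilate q f) * gen p q 0 .x :=
  mul_aeval_of_mul_eq_smul (isWeylFamily_gen p q).xz f

theorem y_mul_poly (f : K[X]) :
    gen p q 0 .y * poly p q f = poly p q (dilate q⁻¹ f) * gen p q 0 .y :=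
  mul_aeval_of_mul_eq_smul (isWeylFamily_gen p q).yz f

theorem poly_mul_x (hq : q ≠ 0) (f : K[X]) :
    poly p q f * gen p q 0 .x = gen p q 0 .x * poly p q (dilate q⁻¹ f) := by
  rw [x_mul_poly, dilate_dilate_of_mul_eq_one (mul_inv_cancel₀ hq)]

theorem poly_mul_y (hq : q ≠ 0) (f : K[X]) :
    poly p q f * gen p q 0 .y = gen p q 0 .y * poly p q (dilate q f) := by
  rw [y_mul_poly, dilate_dilate_of_mul_eq_one (inv_mul_cancel₀ hq)]

theorem exists_poly_mul_pow {a : Weyl p q 0}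
    (h : ∀ f, ∃ g, poly p q f * a = a * poly p q g) (n : ℕ) (f : K[X]) :
    ∃ g, poly p q f * a ^ n = a ^ n * poly p q g := by
  induction n generalizing f with
  | zero => exact ⟨f, by simp⟩
  | succ n ih =>
    obtain ⟨g, hg⟩ := ih f
    obtain ⟨g', hg'⟩ := h g
    exact ⟨g', by rw [pow_succ, ← mul_assoc, hg, mul_assoc, hg', ← mul_assoc]⟩

theorem exists_poly_mul_power (hq : q ≠ 0) (n : ℤ) (f : K[X]) :
    ∃ g, poly p q f * power p q n = power p q n * poly p q g := by
  cases n with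
  | ofNat m => exact exists_poly_mul_pow (fun f => ⟨_, poly_mul_x hq f⟩) m f
  | negSucc m => exact exists_poly_mul_pow (fun f => ⟨_, poly_mul_y hq f⟩) (m + 1) f

/-- A power of `x` gets longer, while a power of `y` loses one factor through `yx = p(z)`. Only the
shape of the result is needed, so the polynomial stays existential. -/
theorem exists_power_mul_x (n : ℤ) :
    ∃ g, power p q n * gen p q 0 .x = power p q (n + 1) * poly p q g := by
  have h := isWeylFamily_gen p q
  obtain m | _ | m := n
  · exact ⟨1, by rw [map_one, mul_one]; exact (pow_succ _ _).symm⟩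
  · refine ⟨p, ?_⟩
    rw [show Int.negSucc 0 + 1 = 0 from rfl, power_zero, one_mul]
    exact (congrArg (· * _) (pow_one _)).trans h.yx
  · refine ⟨p, ?_⟩
    change gen p q 0 .y ^ (m + 1 + 1) * _ = gen p q 0 .y ^ (m + 1) * _
    rw [pow_succ, mul_assoc, h.yx]
    rfl

theorem exists_power_mul_y (n : ℤ) :
    ∃ g, power p q n * gen p q 0 .y = power p q (n - 1) * poly p q g := by
  have h := isWeylFamily_gen p q
  obtain (_ | m) | m := n
  · refine ⟨1, ?_⟩
    rw [map_one, mul_one]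
    change gen p q 0 .x ^ 0 * _ = gen p q 0 .y ^ (0 + 1)
    simp
  · refine ⟨dilate q p, ?_⟩
    rw [show Int.ofNat (m + 1) - 1 = Int.ofNat m by simp]
    change gen p q 0 .x ^ (m + 1) * _ = gen p q 0 .x ^ m * _
    rw [pow_succ, mul_assoc, h.xy]
    rfl
  · exact ⟨1, by rw [map_one, mul_one]; exact (pow_succ _ _).symm⟩

theorem exists_x_mul_power (hq : q ≠ 0) (n : ℤ) :
    ∃ g, gen p q 0 .x * power p q n = power p q (n + 1) * poly p q g := by
  have h := isWeylFamily_gen p q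
  obtain m | _ | m := n
  · exact ⟨1, by rw [map_one, mul_one]; exact (pow_succ' _ _).symm⟩
  · refine ⟨dilate q p, ?_⟩
    rw [show Int.negSucc 0 + 1 = 0 from rfl, power_zero, one_mul]
    exact (congrArg (_ * ·) (pow_one _)).trans h.xy
  · change ∃ g, _ * gen p q 0 .y ^ (m + 1 + 1) = gen p q 0 .y ^ (m + 1) * _
    obtain ⟨g, hg⟩ := exists_poly_mul_power (p := p) hq (.negSucc m) (dilate q p)
    refine ⟨g, ?_⟩
    rw [pow_succ', ← mul_assoc, h.xy]
    exact hg

theorem exists_y_mul_power (hq : q ≠ 0) (n : ℤ) :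
    ∃ g, gen p q 0 .y * power p q n = power p q (n - 1) * poly p q g := by
  have h := isWeylFamily_gen p q
  obtain (_ | m) | m := n
  · refine ⟨1, ?_⟩
    rw [map_one, mul_one]
    change _ * gen p q 0 .x ^ 0 = gen p q 0 .y ^ (0 + 1)
    simp
  · rw [show Int.ofNat (m + 1) - 1 = Int.ofNat m by simp]
    obtain ⟨g, hg⟩ := exists_poly_mul_power (p := p) hq (.ofNat m) p
    refine ⟨g, ?_⟩
    change _ * gen p q 0 .x ^ (m + 1) = _
    rw [pow_succ', ← mul_assoc, h.yx]
    exact hg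
  · exact ⟨1, by rw [map_one, mul_one]; exact (pow_succ' _ _).symm⟩

variable (p q)

/-- The map `(fₙ)ₙ ↦ ∑ xⁿ fₙ(z) + ∑ yⁿ f₋ₙ(z)`. -/
noncomputable def ofFinsupp : (ℤ →₀ K[X]) →ₗ[K] Weyl p q 0 :=
  Finsupp.lsum K fun n => LinearMap.mulLeft K (power p q n) ∘ₗ (poly p q).toLinearMap

variable {p q}

theorem ofFinsupp_single (n : ℤ) (f : K[X]) :
    ofFinsupp p q (Finsupp.single n f) = power p q n * poly p q f := by
  simp [ofFinsupp]

theorem ofFinsupp_surjective (hq : q ≠ 0) : Function.Surjective (ofFinsupp p q) := by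
  intro a
  have hmem (n : ℤ) (f : K[X]) : power p q n * poly p q f ∈ LinearMap.range (ofFinsupp p q) :=
    ⟨_, ofFinsupp_single n f⟩
  refine mem_of_adjoin_eq_top (N := LinearMap.range (ofFinsupp p q)) (adjoin_range_gen p q)
    (by simpa [power_zero] using hmem 0 1) ?_ a
  rintro _ ⟨g, rfl⟩ _ ⟨s, rfl⟩
  induction s using Finsupp.induction_linear with
  | zero => simp
  | add s t hs ht => simpa [add_mul] using Submodule.add_mem _ hs ht
  | single n f =>
    rw [ofFinsupp_single, mul_assoc]
    cases g with
    | x =>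
      obtain ⟨g, hg⟩ := exists_power_mul_x (p := p) (q := q) n
      rw [poly_mul_x hq, ← mul_assoc, hg, mul_assoc, ← map_mul]
      exact hmem _ _
    | y =>
      obtain ⟨g, hg⟩ := exists_power_mul_y (p := p) (q := q) n
      rw [poly_mul_y hq, ← mul_assoc, hg, mul_assoc, ← map_mul]
      exact hmem _ _
    | z =>
      rw [show gen p q 0 .z = poly p q X from (aeval_X _).symm, ← map_mul]
      exact hmem _ _

end Weyl

end Weyl

/-! ### A faithful enough representation of the circle algebra -/

section Representation

variable {K : Type*} [Field K] (pt : K[X]) (qp qm : K)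

/-- The operators of the representation of `Circle pt qp qm` on the functions `ℤ → K[X]`. -/
noncomputable def circleOperator : CircleGen → Module.End K (ℤ → K[X])
  | .zp => LinearMap.mulLeft K fun i => C (qp ^ (-i))
  | .zm => LinearMap.mulLeft K fun i => C (qm ^ (-i)) * X
  | .xp => LinearMap.funLeft K K[X] fun i : ℤ => i + 1
  | .xm => LinearMap.mulLeft K (fun i : ℤ => dilate ((qp * qm) ^ (1 - i)) pt) *
      LinearMap.funLeft K K[X] fun i : ℤ => i - 1

variable {pt qp qm}

theorem aeval_mulLeft_apply (u : ℤ → K[X]) (f : K[X]) (v : ℤ → K[X]) (i : ℤ) :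
    aeval (LinearMap.mulLeft K u) f v i = aeval (u i) f * v i := by
  have h1 : aeval (LinearMap.mulLeft K u) f = LinearMap.mulLeft K (aeval u f) :=
    aeval_algHom_apply (Algebra.lmul K (ℤ → K[X])) u f
  have h2 : aeval (u i) f = aeval u f i :=
    aeval_algHom_apply (Pi.evalAlgHom K (fun _ : ℤ => K[X]) i) u f
  rw [h1, h2]
  rfl

theorem circleOperator_zp_mul_zm : circleOperator pt qp qm .zp * circleOperator pt qp qm .zm =
    LinearMap.mulLeft K fun i => C ((qp * qm) ^ (-i)) * X := by
  refine LinearMap.ext fun v => funext fun i => ?_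
  simp [circleOperator, mul_zpow, mul_assoc, mul_left_comm]

theorem aeval_circleOperator_apply (f : K[X]) (v : ℤ → K[X]) (i : ℤ) :
    aeval (circleOperator pt qp qm .zp * circleOperator pt qp qm .zm) f v i =
      dilate ((qp * qm) ^ (-i)) f * v i := by
  rw [circleOperator_zp_mul_zm, aeval_mulLeft_apply]
  rfl

/-- At the point `i`, `z₊z₋` multiplies by `q^(-i) X`, where `q = qp * qm`. The weight of `x₋` is
`pt(q^(1-i) X)`, so that after the shift `x₊` it becomes `pt(q^(-i) X)`, as `x₊x₋ = pt(z₊z₋)`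
demands; the shifts account for the factors in the other relations. -/
theorem isCircleFamily_circleOperator (hqp : qp ≠ 0) (hqm : qm ≠ 0) :
    IsCircleFamily pt qp qm (circleOperator pt qp qm) := by
  have hq : qp * qm ≠ 0 := mul_ne_zero hqp hqm
  constructor <;> refine LinearMap.ext fun v => funext fun i => ?_
  · simp only [circleOperator, Module.End.mul_apply, LinearMap.mulLeft_apply, Pi.mul_apply]
    ring
  · rw [aeval_circleOperator_apply]
    simp [circleOperator, LinearMap.funLeft_apply]
  · rw [← aeval_dilate, aeval_circleOperator_apply, dilate_dilate, ← zpow_add_one₀ hq]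
    simp [circleOperator, LinearMap.funLeft_apply, neg_add_eq_sub]
  · simp [circleOperator, LinearMap.funLeft_apply, smul_eq_C_mul, zpow_add₀ hqp]
    ring
  · simp [circleOperator, LinearMap.funLeft_apply, smul_eq_C_mul, zpow_add₀ hqm]
    ring
  · simp [circleOperator, LinearMap.funLeft_apply, smul_eq_C_mul, zpow_sub₀ hqp,
      div_eq_mul_inv, C_mul]
    ring
  · simp [circleOperator, LinearMap.funLeft_apply, smul_eq_C_mul, zpow_sub₀ hqm,
      div_eq_mul_inv, C_mul]
    ring

/-- The representation of `Circle pt qp qm` on the functions `ℤ → K[X]`. -/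
noncomputable def circleRepresentation (hqp : qp ≠ 0) (hqm : qm ≠ 0) :
    Circle pt qp qm →ₐ[K] Module.End K (ℤ → K[X]) :=
  Circle.lift (isCircleFamily_circleOperator hqp hqm)

theorem pow_mulLeft_apply (u v : ℤ → K[X]) (n : ℕ) (i : ℤ) :
    (LinearMap.mulLeft K u ^ n) v i = u i ^ n * v i := by
  have h := aeval_mulLeft_apply u (X ^ n) v i
  rwa [map_pow, map_pow, aeval_X, aeval_X] at h

end Representation

/-! ### The Weyl algebra as the degree-zero part -/

section Embedding

variable {K : Type*} [Field K] {pt : K[X]} {qp qm : K}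

open CircleBundle.Circle in
/-- The images of the generators under the embedding of `Weyl p q 0` into `Circle pt qp qm`. -/
noncomputable def weylImage (pt : K[X]) (qp qm : K) (k : ℕ) : WeylGen → Circle pt qp qm
  | .x => gen pt qp qm .xm * gen pt qp qm .zp ^ k
  | .y => gen pt qp qm .zm ^ k * gen pt qp qm .xp
  | .z => gen pt qp qm .zp * gen pt qp qm .zm

open CircleBundle.Circle in
-- With `w = z₊z₋`, the inner `z`-powers give `x₋ wᵏ x₊ = (qw)ᵏ pt(qw)`, and the inner `x₊x₋` gives
-- `z₋ᵏ pt(w) z₊ᵏ = wᵏ pt(w)`.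
theorem isWeylFamily_weylImage (k : ℕ) :
    IsWeylFamily (X ^ k * pt) (qp * qm) (weylImage pt qp qm k) := by
  have h := isCircleFamily_gen pt qp qm
  have hw : aeval (gen pt qp qm .zp * gen pt qp qm .zm) (X : K[X]) =
    gen pt qp qm .zp * gen pt qp qm .zm := aeval_X _
  constructor <;> simp only [weylImage]
  · rw [← mul_assoc, mul_assoc (gen pt qp qm .xm), zp_pow_mul_zm_pow, xm_mul_aeval, mul_assoc,
      h.xmxp, ← aeval_dilate, ← map_mul, ← map_mul]
  · rw [← mul_assoc, mul_assoc (_ ^ k), h.xpxm, (commute_zm_pow_aeval k pt).eq, mul_assoc,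
      zm_pow_mul_zp_pow, ← map_mul, mul_comm]
  · rw [← hw, mul_assoc, (commute_zp_pow_aeval k X).eq, ← mul_assoc, xm_mul_aeval, aeval_dilate,
      aeval_X, hw, smul_mul_assoc, smul_mul_assoc, mul_assoc]
  · rw [← hw, mul_assoc, xp_mul_aeval, ← mul_assoc, (commute_zm_pow_aeval k _).eq, aeval_dilate,
      aeval_X, hw, smul_mul_assoc, smul_mul_assoc, mul_assoc]

/-- The embedding of `Weyl p q 0` into `Circle pt qp qm`. -/
noncomputable def weylToCircle (pt : K[X]) (qp qm : K) (k : ℕ) :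
    Weyl (X ^ k * pt) (qp * qm) 0 →ₐ[K] Circle pt qp qm :=
  Weyl.lift (isWeylFamily_weylImage k)

theorem weylToCircle_gen (k : ℕ) (g : WeylGen) :
    weylToCircle pt qp qm k (Weyl.gen _ _ 0 g) = weylImage pt qp qm k g :=
  Weyl.lift_gen _ g

theorem representation_x (hqp : qp ≠ 0) (hqm : qm ≠ 0) (hpt : pt ≠ 0) (k : ℕ) (n : ℤ) :
    ∃ c : K[X], c ≠ 0 ∧ ∀ f, circleRepresentation hqp hqm
      (weylToCircle pt qp qm k (Weyl.gen _ _ 0 .x)) (Pi.single n f) = Pi.single (n + 1) (c * f) := by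
  refine ⟨dilate ((qp * qm) ^ (-n)) pt * C (qp ^ (-n)) ^ k, mul_ne_zero ?_ ?_, fun f => ?_⟩
  · intro h
    have h' := congrArg (dilate ((qp * qm) ^ n)) h
    rw [dilate_dilate_of_mul_eq_one, map_zero] at h'
    · exact hpt h'
    · rw [← zpow_add₀ (mul_ne_zero hqp hqm), add_neg_cancel, zpow_zero]
  · exact pow_ne_zero _ (C_ne_zero.2 (zpow_ne_zero _ hqp))
  · rw [weylToCircle_gen, weylImage, map_mul, map_pow, circleRepresentation, Circle.lift_gen,
      Circle.lift_gen]
    funext i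
    simp only [circleOperator, Module.End.mul_apply, LinearMap.mulLeft_apply, Pi.mul_apply,
      LinearMap.funLeft_apply, pow_mulLeft_apply]
    by_cases hi : i = n + 1
    · subst hi
      simp [mul_assoc]
    · simp [hi, show i - 1 ≠ n by omega]

theorem representation_y (hqp : qp ≠ 0) (hqm : qm ≠ 0) (k : ℕ) (n : ℤ) :
    ∃ c : K[X], c ≠ 0 ∧ ∀ f, circleRepresentation hqp hqm
      (weylToCircle pt qp qm k (Weyl.gen _ _ 0 .y)) (Pi.single n f) = Pi.single (n - 1) (c * f) := by
  refine ⟨(C (qm ^ (-(n - 1))) * X) ^ k, pow_ne_zero _ (mul_ne_zero ?_ X_ne_zero), fun f => ?_⟩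
  · exact C_ne_zero.2 (zpow_ne_zero _ hqm)
  · rw [weylToCircle_gen, weylImage, map_mul, map_pow, circleRepresentation, Circle.lift_gen,
      Circle.lift_gen]
    funext i
    simp only [circleOperator, Module.End.mul_apply,
      LinearMap.funLeft_apply, pow_mulLeft_apply]
    by_cases hi : i = n - 1
    · subst hi
      simp
    · simp [hi, show i + 1 ≠ n by omega]

theorem representation_power (hqp : qp ≠ 0) (hqm : qm ≠ 0) (hpt : pt ≠ 0) (k : ℕ) (n : ℤ) :
    ∃ c : K[X], c ≠ 0 ∧ ∀ f, circleRepresentation hqp hqm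
      (weylToCircle pt qp qm k (Weyl.power _ _ n)) (Pi.single 0 f) = Pi.single n (c * f) := by
  have hx (m : ℕ) : ∃ c : K[X], c ≠ 0 ∧ ∀ f, circleRepresentation hqp hqm
      (weylToCircle pt qp qm k (Weyl.gen _ _ 0 .x ^ m)) (Pi.single 0 f) =
        Pi.single (m : ℤ) (c * f) := by
    induction m with
    | zero => exact ⟨1, one_ne_zero, by simp⟩
    | succ m ih =>
      obtain ⟨c, hc, h⟩ := ih
      obtain ⟨d, hd, h'⟩ := representation_x (pt := pt) hqp hqm hpt k m
      refine ⟨d * c, mul_ne_zero hd hc, fun f => ?_⟩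
      rw [pow_succ', map_mul, map_mul, Module.End.mul_apply, h, h', mul_assoc, Nat.cast_succ]
  have hy (m : ℕ) : ∃ c : K[X], c ≠ 0 ∧ ∀ f, circleRepresentation hqp hqm
      (weylToCircle pt qp qm k (Weyl.gen _ _ 0 .y ^ m)) (Pi.single 0 f) =
        Pi.single (-m : ℤ) (c * f) := by
    induction m with
    | zero => exact ⟨1, one_ne_zero, by simp⟩
    | succ m ih =>
      obtain ⟨c, hc, h⟩ := ih
      obtain ⟨d, hd, h'⟩ := representation_y (pt := pt) hqp hqm k (-m)
      refine ⟨d * c, mul_ne_zero hd hc, fun f => ?_⟩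
      rw [pow_succ', map_mul, map_mul, Module.End.mul_apply, h, h', mul_assoc, Nat.cast_succ,
        neg_add']
  cases n with
  | ofNat m => exact hx m
  | negSucc m => exact hy (m + 1)

/-- Acting on the function equal to `1` at `0` and zero elsewhere, the image of `(fₙ)ₙ` takes the
value `cₙ fₙ` at `n`, with `cₙ ≠ 0` in a domain. Linear independence in the Weyl algebra and
injectivity of the embedding both follow. -/
theorem ofFinsupp_comp_injective (hqp : qp ≠ 0) (hqm : qm ≠ 0) (hpt : pt ≠ 0) (k : ℕ) :
    Function.Injective fun s => weylToCircle pt qp qm k (Weyl.ofFinsupp _ _ s) := by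
  choose c hc h using representation_power (pt := pt) hqp hqm hpt k
  have hz (f : K[X]) : circleRepresentation hqp hqm (weylToCircle pt qp qm k (Weyl.poly _ _ f))
      (Pi.single 0 1) = Pi.single 0 f := by
    rw [Weyl.poly, ← aeval_algHom_apply, ← aeval_algHom_apply, weylToCircle_gen, weylImage,
      map_mul, circleRepresentation, Circle.lift_gen, Circle.lift_gen]
    funext i
    rw [aeval_circleOperator_apply]
    by_cases hi : i = 0
    · subst hi
      simp [dilate_one]
    · simp [hi]
  have key (s : ℤ →₀ K[X]) (n : ℤ) : circleRepresentation hqp hqm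
      (weylToCircle pt qp qm k (Weyl.ofFinsupp _ _ s)) (Pi.single 0 1) n = c n * s n := by
    induction s using Finsupp.induction_linear with
    | zero => simp
    | add s t hs ht => simp only [map_add, LinearMap.add_apply, Pi.add_apply, hs, ht,
        Finsupp.add_apply, mul_add]
    | single m f =>
      rw [Weyl.ofFinsupp_single, map_mul, map_mul, Module.End.mul_apply, hz, h]
      by_cases hm : n = m
      · subst hm
        simp
      · simp [hm]
  intro s t hst
  refine Finsupp.ext fun n => mul_left_cancel₀ (hc n) ?_
  rw [← key, ← key]
  exact congrArg (fun a => circleRepresentation hqp hqm a (Pi.single 0 1) n) hst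

theorem weylToCircle_injective (hqp : qp ≠ 0) (hqm : qm ≠ 0) (hpt : pt ≠ 0) (k : ℕ) :
    Function.Injective (weylToCircle pt qp qm k) := by
  intro a b hab
  obtain ⟨s, rfl⟩ := Weyl.ofFinsupp_surjective (mul_ne_zero hqp hqm) a
  obtain ⟨t, rfl⟩ := Weyl.ofFinsupp_surjective (mul_ne_zero hqp hqm) b
  rw [ofFinsupp_comp_injective hqp hqm hpt k hab]

/-- The basis of `Weyl p q 0` over the polynomials in `z`. -/
noncomputable def weylEquiv (hqp : qp ≠ 0) (hqm : qm ≠ 0) (hpt : pt ≠ 0) (k : ℕ) :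
    (ℤ →₀ K[X]) ≃ₗ[K] Weyl (X ^ k * pt) (qp * qm) 0 :=
  LinearEquiv.ofBijective (Weyl.ofFinsupp _ _)
    ⟨fun _ _ h => ofFinsupp_comp_injective hqp hqm hpt k (congrArg (weylToCircle pt qp qm k) h),
      Weyl.ofFinsupp_surjective (mul_ne_zero hqp hqm)⟩

theorem weylToCircle_mem (k : ℕ) (a : Weyl (X ^ k * pt) (qp * qm) 0) :
    weylToCircle pt qp qm k a ∈ Circle.grading pt qp qm k 0 := by
  have h : Algebra.adjoin K (Set.range (Weyl.gen (X ^ k * pt) (qp * qm) 0)) ≤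
      (SetLike.GradeZero.subalgebra (Circle.grading pt qp qm k)).comap
        (weylToCircle pt qp qm k) := by
    refine Algebra.adjoin_le ?_
    rintro _ ⟨g, rfl⟩
    change weylToCircle pt qp qm k _ ∈ Circle.grading pt qp qm k 0
    rw [weylToCircle_gen]
    cases g
    · have := SetLike.mul_mem_graded (Circle.gen_mem_grading (pt := pt) (qp := qp) (qm := qm) k .xm)
        (Circle.pow_gen_mem_grading (k := k) k .zp)
      simpa [CircleGen.degree, weylImage] using this
    · have := SetLike.mul_mem_graded
        (Circle.pow_gen_mem_grading (pt := pt) (qp := qp) (qm := qm) (k := k) k .zm)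
        (Circle.gen_mem_grading k .xp)
      simpa [CircleGen.degree, weylImage] using this
    · have := SetLike.mul_mem_graded (Circle.gen_mem_grading (pt := pt) (qp := qp) (qm := qm) k .zp)
        (Circle.gen_mem_grading k .zm)
      simpa [CircleGen.degree, weylImage] using this
  rw [Weyl.adjoin_range_gen] at h
  exact h Algebra.mem_top

theorem weylToCircle_mem_zero_mul (k : ℕ) (a : Weyl (X ^ k * pt) (qp * qm) 0) :
    weylToCircle pt qp qm k a ∈ Circle.grading pt qp qm k (0 * k) := by
  rw [zero_mul]
  exact weylToCircle_mem k a

/-- The isomorphism of `Weyl p q 0` onto the degree-zero part of the Veronese subalgebra. -/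
noncomputable def weylEquivDegreeZero (hqp : qp ≠ 0) (hqm : qm ≠ 0) (hpt : pt ≠ 0) (k : ℕ) :
    Weyl (X ^ k * pt) (qp * qm) 0 ≃ₐ[K] degreeZero (Circle.veroneseGrading pt qp qm k) :=
  AlgEquiv.ofBijective
    (((weylToCircle pt qp qm k).codRestrict (veronese (Circle.grading pt qp qm k) k)
      fun a => mem_veronese (weylToCircle_mem_zero_mul k a)).codRestrict
        (degreeZero (Circle.veroneseGrading pt qp qm k)) (weylToCircle_mem_zero_mul k))
    ⟨fun a b hab => weylToCircle_injective hqp hqm hpt k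
      (congrArg (fun c : degreeZero (Circle.veroneseGrading pt qp qm k) => c.1.1) hab), by
      rintro ⟨⟨a, ha⟩, ha'⟩
      have ha0 : a ∈ Circle.grading pt qp qm k (0 * k) := ha'
      rw [zero_mul] at ha0
      obtain ⟨b, rfl⟩ := Circle.mem_of_mem_grading_zero hqp hqm
        (S := (weylToCircle pt qp qm k).range) ⟨_, weylToCircle_gen k .x⟩
        ⟨_, weylToCircle_gen k .y⟩ ⟨_, weylToCircle_gen k .z⟩ ha0
      exact ⟨b, rfl⟩⟩

theorem coe_weylEquivDegreeZero (hqp : qp ≠ 0) (hqm : qm ≠ 0) (hpt : pt ≠ 0) (k : ℕ)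
    (a : Weyl (X ^ k * pt) (qp * qm) 0) :
    (weylEquivDegreeZero hqp hqm hpt k a).1.1 = weylToCircle pt qp qm k a := rfl

end Embedding

end CircleBundle

namespace CircleBundle

/-! ### The functional `τ_ζ`: existence, uniqueness, trace property -/

section Functional

variable {K L : Type*} [Field K] [Field L] [Algebra K L]

/-- The functional `zⁿ ↦ ζⁿ / (1 - qⁿ)`, `1 ↦ 0` on the polynomials. -/
noncomputable def polyFunctional (q : K) (ζ : L) : K[X] →ₗ[K] L :=
  (basisMonomials K).constr K fun n => if n ≠ 0 then ζ ^ n / (1 - algebraMap K L q ^ n) else 0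

theorem polyFunctional_X_pow (q : K) (ζ : L) (n : ℕ) : polyFunctional q ζ (X ^ n) =
    if n ≠ 0 then ζ ^ n / (1 - algebraMap K L q ^ n) else 0 := by
  have := (basisMonomials K).constr_basis K
    (fun n => if n ≠ 0 then ζ ^ n / (1 - algebraMap K L q ^ n) else 0) n
  rw [coe_basisMonomials] at this
  rwa [← monomial_one_right_eq_X_pow]

theorem polyFunctional_one (q : K) (ζ : L) : polyFunctional q ζ 1 = 0 := by
  simpa using polyFunctional_X_pow q ζ 0

/-- For `n > 0` this is `qⁿ/(1 - qⁿ) = 1/(1 - qⁿ) - 1` times `ζⁿ`. The term `f(0)` compensates for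
the constant monomial, where the functional vanishes but evaluation at `ζ` does not. -/
theorem polyFunctional_dilate {q : K} (hq : ∀ j : ℕ, 0 < j → q ^ j ≠ 1) (ζ : L) (f : K[X]) :
    polyFunctional q ζ (dilate q f) =
      polyFunctional q ζ f - aeval ζ f + algebraMap K L (f.eval 0) := by
  induction f using Polynomial.induction_on' with
  | add f g hf hg =>
    simp only [map_add, hf, hg, eval_add]
    ring
  | monomial n r =>
    rw [← C_mul_X_pow_eq_monomial, ← smul_eq_C_mul, map_smul,
      map_smul, map_smul, map_smul, dilate, map_pow, aeval_X, mul_pow, ← C_pow, ← smul_eq_C_mul,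
      map_smul, polyFunctional_X_pow, eval_smul, map_pow, aeval_X, eval_pow, eval_X]
    rcases eq_or_ne n 0 with rfl | hn
    · simp [Algebra.smul_def]
    · have h1 : (1 : L) - algebraMap K L q ^ n ≠ 0 := by
        rw [sub_ne_zero, ← map_pow, ← map_one (algebraMap K L)]
        exact fun h => hq n (Nat.pos_of_ne_zero hn) ((algebraMap K L).injective h).symm
      simp only [ne_eq, hn, not_false_eq_true, if_true, Algebra.smul_def, map_pow, zero_pow hn,
        mul_zero, map_zero, add_zero]
      field_simp
      ring

namespace Weyl

variable {p : K[X]} {q : K}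

theorem isTau_apply {ζ : L} {τ : Weyl p q 0 →ₗ[K] L} (hτ : IsTau p q ζ τ) (n : ℤ) (f : K[X]) :
    τ (power p q n * poly p q f) = if n = 0 then polyFunctional q ζ f else 0 := by
  induction f using Polynomial.induction_on' with
  | add f g hf hg =>
    rw [map_add, mul_add, map_add, hf, hg]
    split_ifs <;> simp
  | monomial j r =>
    have hj : τ (power p q n * gen p q 0 .z ^ j) =
        if n = 0 then polyFunctional q ζ (X ^ j) else 0 := by
      rw [polyFunctional_X_pow]
      obtain ⟨m, rfl | rfl⟩ := n.eq_nat_or_neg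
      · rw [power_natCast, (hτ m j).1]
        by_cases hm : m = 0 <;> simp [hm]
      · rw [power_neg_natCast, (hτ m j).2]
        by_cases hm : m = 0 <;> simp [hm]
    rw [← C_mul_X_pow_eq_monomial, ← smul_eq_C_mul, map_smul,
      mul_smul_comm, map_smul, map_smul, map_pow, poly, aeval_X, hj]
    split_ifs <;> simp

theorem isTau_unique (hq : q ≠ 0) {ζ : L} {τ τ' : Weyl p q 0 →ₗ[K] L} (hτ : IsTau p q ζ τ)
    (hτ' : IsTau p q ζ τ') : τ = τ' := by
  refine LinearMap.ext fun a => ?_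
  obtain ⟨s, rfl⟩ := ofFinsupp_surjective hq a
  induction s using Finsupp.induction_linear with
  | zero => simp
  | add s t hs ht => simp only [map_add, hs, ht]
  | single n f => rw [ofFinsupp_single, isTau_apply hτ, isTau_apply hτ']

theorem isTau_poly {ζ : L} {τ : Weyl p q 0 →ₗ[K] L} (hτ : IsTau p q ζ τ) (f : K[X]) :
    τ (poly p q f) = polyFunctional q ζ f := by
  simpa [power_zero] using isTau_apply hτ 0 f

/-- Only the part without `x` or `y` contributes to `τ`, so for `x` and `y` the sole non-trivial
cases are `n = -1` and `n = 1`. There the two products are a multiple of `p` and its dilation, on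
which `τ` agrees because `p` vanishes at `ζ` and at `0`. -/
theorem isTau_mul_gen_comm (hq0 : q ≠ 0) (hq : ∀ j : ℕ, 0 < j → q ^ j ≠ 1) {ζ : L}
    (hζ : aeval ζ p = 0) (h0 : p.eval 0 = 0) {τ : Weyl p q 0 →ₗ[K] L} (hτ : IsTau p q ζ τ)
    (a : Weyl p q 0) (g : WeylGen) : τ (a * gen p q 0 g) = τ (gen p q 0 g * a) := by
  have h := isWeylFamily_gen p q
  have hL (f : K[X]) :
      polyFunctional q ζ (dilate q (p * f)) = polyFunctional q ζ (p * f) := by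
    rw [polyFunctional_dilate hq, map_mul (aeval ζ), hζ, eval_mul, h0]
    simp
  have hxy : gen p q 0 .x * gen p q 0 .y = poly p q (dilate q p) := h.xy
  have hyx : gen p q 0 .y * gen p q 0 .x = poly p q p := h.yx
  obtain ⟨s, rfl⟩ := ofFinsupp_surjective hq0 a
  induction s using Finsupp.induction_linear with
  | zero => simp
  | add s t hs ht => simp only [map_add, add_mul, mul_add, hs, ht]
  | single n f =>
    rw [ofFinsupp_single]
    cases g with
    | x =>
      by_cases hn : n = -1
      · subst hn
        have e : power p q (-1) = gen p q 0 .y := pow_one _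
        rw [e, ← mul_assoc, hxy, mul_assoc, poly_mul_x hq0, ← mul_assoc, hyx, ← map_mul,
          ← map_mul, isTau_poly hτ, isTau_poly hτ, ← hL, map_mul,
          dilate_dilate_of_mul_eq_one (mul_inv_cancel₀ hq0)]
      · obtain ⟨g, hg⟩ := exists_power_mul_x (p := p) (q := q) n
        obtain ⟨g', hg'⟩ := exists_x_mul_power (p := p) hq0 n
        rw [mul_assoc, poly_mul_x hq0, ← mul_assoc, hg, ← mul_assoc, hg', mul_assoc, mul_assoc,
          ← map_mul, ← map_mul, isTau_apply hτ, isTau_apply hτ, if_neg (by omega),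
          if_neg (by omega)]
    | y =>
      by_cases hn : n = 1
      · subst hn
        have e : power p q 1 = gen p q 0 .x := pow_one _
        rw [e, ← mul_assoc, hyx, mul_assoc, poly_mul_y hq0, ← mul_assoc, hxy, ← map_mul,
          ← map_mul, ← map_mul, isTau_poly hτ, isTau_poly hτ, hL]
      · obtain ⟨g, hg⟩ := exists_power_mul_y (p := p) (q := q) n
        obtain ⟨g', hg'⟩ := exists_y_mul_power (p := p) hq0 n
        rw [mul_assoc, poly_mul_y hq0, ← mul_assoc, hg, ← mul_assoc, hg', mul_assoc, mul_assoc,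
          ← map_mul, ← map_mul, isTau_apply hτ, isTau_apply hτ, if_neg (by omega),
          if_neg (by omega)]
    | z =>
      rw [show gen p q 0 .z = poly p q X from (aeval_X _).symm, mul_assoc, ← map_mul]
      by_cases hn : n = 0
      · subst hn
        rw [power_zero, one_mul, one_mul, ← map_mul, mul_comm]
      · obtain ⟨g, hg⟩ := exists_poly_mul_power (p := p) hq0 n X
        rw [← mul_assoc, hg, mul_assoc, ← map_mul, isTau_apply hτ, isTau_apply hτ, if_neg hn,
          if_neg hn]

theorem isTau_mul_comm (hq0 : q ≠ 0) (hq : ∀ j : ℕ, 0 < j → q ^ j ≠ 1) {ζ : L}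
    (hζ : aeval ζ p = 0) (h0 : p.eval 0 = 0) {τ : Weyl p q 0 →ₗ[K] L} (hτ : IsTau p q ζ τ)
    (a b : Weyl p q 0) : τ (a * b) = τ (b * a) := by
  have hb : b ∈ Algebra.adjoin K (Set.range (gen p q 0)) :=
    adjoin_range_gen p q ▸ Algebra.mem_top
  induction hb using Algebra.adjoin_induction generalizing a with
  | mem b hb =>
    obtain ⟨g, rfl⟩ := hb
    exact isTau_mul_gen_comm hq0 hq hζ h0 hτ a g
  | algebraMap r => rw [Algebra.commutes]
  | add b c _ _ hb hc => simp only [add_mul, mul_add, map_add, hb, hc]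
  | mul b c _ _ hb hc => rw [← mul_assoc, hc, ← mul_assoc, hb, mul_assoc]

end Weyl

/-- Take the coordinate at `0` in the basis `xⁿ f(z)`, `yⁿ f(z)`, followed by `polyFunctional`. -/
theorem exists_isTau {pt : K[X]} {qp qm : K} (hqp : qp ≠ 0) (hqm : qm ≠ 0) (hpt : pt ≠ 0) (k : ℕ)
    (ζ : L) : ∃ τ : Weyl (X ^ k * pt) (qp * qm) 0 →ₗ[K] L, IsTau _ _ ζ τ := by
  refine ⟨polyFunctional (qp * qm) ζ ∘ₗ Finsupp.lapply 0 ∘ₗ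
    (weylEquiv hqp hqm hpt k).symm.toLinearMap, fun m n => ?_⟩
  have key (i : ℤ) : (weylEquiv hqp hqm hpt k).symm
      (Weyl.power _ _ i * Weyl.gen _ _ 0 .z ^ n) = Finsupp.single i (X ^ n) := by
    rw [LinearEquiv.symm_apply_eq]
    refine ((Weyl.ofFinsupp_single _ _).trans ?_).symm
    rw [map_pow, Weyl.poly, aeval_X]
  rw [← Weyl.power_natCast, ← Weyl.power_neg_natCast]
  simp only [LinearMap.comp_apply, LinearEquiv.coe_coe, key, Finsupp.lapply_apply]
  rcases eq_or_ne m 0 with rfl | hm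
  · simp [polyFunctional_X_pow]
  · simp [hm]

end Functional

/-! ### The components as modules and the value of the trace -/

section Components

variable {K : Type*} [Field K] {pt : K[X]} {qp qm : K} {k : ℕ}

theorem exists_isDualFamily_veronese (hqp : qp ≠ 0) (hqm : qm ≠ 0) (hpt : pt.eval 0 ≠ 0)
    (hk : k ≠ 0) (n : ℤ) :
    ∃ (ι : Type) (_ : Fintype ι) (a b : ι → veronese (Circle.grading pt qp qm k) k),
      IsDualFamily (Circle.veroneseGrading pt qp qm k) n a b := by
  obtain ⟨ι, _, a, b, f, h, -⟩ := Circle.exists_isDualFamily (mul_ne_zero hqp hqm) hpt hk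
    (0 : K[X] →ₗ[K] K) 0 (by simp) n
  exact ⟨ι, _, _, _, h.veronese⟩

theorem isStronglyGraded_veroneseGrading (hqp : qp ≠ 0) (hqm : qm ≠ 0) (hpt : pt.eval 0 ≠ 0)
    (hk : k ≠ 0) : IsStronglyGraded (Circle.veroneseGrading pt qp qm k) :=
  isStronglyGraded_of_isDualFamily (isInternal_veroneseGrading Circle.isInternal_grading hk)
    (exists_isDualFamily_veronese hqp hqm hpt hk)

/-- The pairing of `τ_ζ` with the class of the component of degree `n`. -/
theorem isTau_trace {L : Type*} [Field L] [Algebra K L] (hqp : qp ≠ 0) (hqm : qm ≠ 0)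
    (hpt : pt.eval 0 ≠ 0) (hk : k ≠ 0) (hpt0 : pt ≠ 0) (hq : ∀ j : ℕ, 0 < j → (qp * qm) ^ j ≠ 1)
    {ζ : L} (hζ : aeval ζ pt = 0) {τ : Weyl (X ^ k * pt) (qp * qm) 0 →ₗ[K] L}
    (hτ : IsTau _ _ ζ τ) (n : ℤ) {N : ℕ}
    {E : Matrix (Fin N) (Fin N) (degreeZero (Circle.veroneseGrading pt qp qm k))}
    (hE : IsIdempotentFor (Circle.veroneseGrading pt qp qm k) n E) :
    τ ((weylEquivDegreeZero hqp hqm hpt0 k).symm E.trace) = -(n : L) := by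
  classical
  obtain ⟨ι, _, a, b, f, h, hba, -, hf⟩ := Circle.exists_isDualFamily (mul_ne_zero hqp hqm) hpt hk
    -- On multiples of `pt` the term `g(ζ)` drops out of the dilation formula, so the constant is `c
    -- = 1`.
    (polyFunctional (qp * qm) ζ) 1 (fun g => by
      rw [polyFunctional_dilate hq, map_mul (aeval ζ), hζ, mul_zero, sub_zero, Algebra.algebraMap_eq_smul_one])
    n
  obtain ⟨θ⟩ := hE.iso
  obtain ⟨θ'⟩ := h.veronese.nonempty_equiv
  have hcomm (a b : degreeZero (Circle.veroneseGrading pt qp qm k)) :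
      τ ((weylEquivDegreeZero hqp hqm hpt0 k).symm (a * b)) =
        τ ((weylEquivDegreeZero hqp hqm hpt0 k).symm (b * a)) := by
    rw [map_mul (weylEquivDegreeZero hqp hqm hpt0 k).symm,
      map_mul (weylEquivDegreeZero hqp hqm hpt0 k).symm]
    exact Weyl.isTau_mul_comm (mul_ne_zero hqp hqm) hq (by simp [hζ]) (by simp [hk]) hτ _ _
  -- `E` and the dual-family idempotent present the same module, so `E` may be replaced by the one
  -- whose trace is `f(z)`.
  have htr := map_trace_eq_of_equiv
    ((τ.toAddMonoidHom).comp (weylEquivDegreeZero hqp hqm hpt0 k).symm.toAddEquiv.toAddMonoidHom)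
    hcomm hE.mul_self h.veronese.matrix_mul_self (θ.symm.trans θ')
  have hmat : (weylEquivDegreeZero hqp hqm hpt0 k).symm h.veronese.matrix.trace =
      Weyl.poly _ _ f := by
    rw [AlgEquiv.symm_apply_eq]
    refine Subtype.ext (Subtype.ext ?_)
    rw [h.veronese.coe_trace_matrix, coe_weylEquivDegreeZero, Weyl.poly, ← aeval_algHom_apply,
      weylToCircle_gen]
    simpa [weylImage] using hba
  refine htr.trans ((congrArg τ hmat).trans ?_)
  rw [Weyl.isTau_poly hτ, hf, polyFunctional_one]
  simp

theorem isIdempotentFor_of_free {R : Type*} [Ring R] [Algebra K R] {𝒢 : ℤ → Submodule K R}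
    [SetLike.GradedMonoid 𝒢] {n : ℤ} (hfin : Module.Finite (degreeZero 𝒢) (leftComponent 𝒢 n))
    (hfree : IsFreeComponent 𝒢 n) :
    ∃ N : ℕ, IsIdempotentFor 𝒢 n (1 : Matrix (Fin N) (Fin N) (degreeZero 𝒢)) := by
  have : Module.Free (degreeZero 𝒢) (leftComponent 𝒢 n) := hfree
  let e := ((Module.Free.chooseBasis (degreeZero 𝒢) (leftComponent 𝒢 n)).reindex
    (Fintype.equivFin _)).equivFun
  refine ⟨_, one_mul 1, ⟨e.trans (LinearEquiv.ofTop _ ?_).symm⟩⟩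
  exact LinearMap.range_eq_top.2 fun v => ⟨v, by simp⟩

theorem exists_isIdempotentFor {R : Type*} [Ring R] [Algebra K R] {𝒢 : ℤ → Submodule K R}
    [SetLike.GradedMonoid 𝒢] {n : ℤ} {ι : Type*} [Fintype ι] {a b : ι → R}
    (h : IsDualFamily 𝒢 n a b) :
    ∃ (N : ℕ) (E : Matrix (Fin N) (Fin N) (degreeZero 𝒢)), IsIdempotentFor 𝒢 n E := by
  have h' : IsDualFamily 𝒢 n (a ∘ (Fintype.equivFin ι).symm) (b ∘ (Fintype.equivFin ι).symm) :=
    ⟨fun i => h.left_mem _, fun i => h.right_mem _, by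
      rw [← h.sum_mul]
      exact Equiv.sum_comp (Fintype.equivFin ι).symm fun i => a i * b i⟩
  exact ⟨_, h'.matrix, h'.matrix_mul_self, h'.nonempty_equiv⟩

/-- An invertible element of degree `n` identifies the components of degrees `0` and `n`. -/
theorem nonempty_leftComponent_equiv {R : Type*} [Ring R] [Algebra K R] {𝒢 : ℤ → Submodule K R}
    [SetLike.GradedMonoid 𝒢] {n : ℤ} {u v : R} (hu : u ∈ 𝒢 n) (hv : v ∈ 𝒢 (-n))
    (huv : u * v = 1) (hvu : v * u = 1) :
    Nonempty (leftComponent 𝒢 n ≃ₗ[degreeZero 𝒢] leftComponent 𝒢 0) := by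
  refine ⟨{
    toFun := fun c => ⟨c * v, ?_⟩
    invFun := fun c => ⟨c * u, ?_⟩
    map_add' := fun c d => Subtype.ext (add_mul _ _ _)
    map_smul' := fun r c => Subtype.ext (mul_assoc _ _ _)
    left_inv := fun c => Subtype.ext ?_
    right_inv := fun c => Subtype.ext ?_ }⟩
  · have := SetLike.mul_mem_graded (A := 𝒢) c.2 hv
    rwa [add_neg_cancel] at this
  · have := SetLike.mul_mem_graded (A := 𝒢) c.2 hu
    rwa [zero_add] at this
  · simp [mul_assoc, hvu]
  · simp [mul_assoc, huv]

/-- For constant `pt = c` both `x₊x₋` and `x₋x₊` equal `c`, so `x₊` is invertible, and it has degree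
`1` in the Veronese grading. -/
theorem nonempty_leftComponent_one_equiv {c : K} (hc : c ≠ 0) :
    Nonempty (leftComponent (Circle.veroneseGrading (C c) qp qm k) 1 ≃ₗ[degreeZero
      (Circle.veroneseGrading (C c) qp qm k)]
        leftComponent (Circle.veroneseGrading (C c) qp qm k) 0) := by
  have h := Circle.isCircleFamily_gen (C c) qp qm
  have hp : Circle.gen (C c) qp qm .xp ∈ Circle.grading (C c) qp qm k (1 * k) := by
    simpa [CircleGen.degree] using Circle.gen_mem_grading (pt := C c) (qp := qp) (qm := qm) k .xp
  have hm : c⁻¹ • Circle.gen (C c) qp qm .xm ∈ Circle.grading (C c) qp qm k (-1 * k) := by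
    refine Submodule.smul_mem _ _ ?_
    simpa [CircleGen.degree] using Circle.gen_mem_grading (pt := C c) (qp := qp) (qm := qm) k .xm
  refine nonempty_leftComponent_equiv (u := ⟨_, mem_veronese hp⟩) (v := ⟨_, mem_veronese hm⟩)
    hp hm (Subtype.ext ?_) (Subtype.ext ?_)
  · change Circle.gen (C c) qp qm .xp * (c⁻¹ • Circle.gen (C c) qp qm .xm) = 1
    rw [mul_smul_comm, h.xpxm, aeval_C, Algebra.algebraMap_eq_smul_one, inv_smul_smul₀ hc]
  · change c⁻¹ • Circle.gen (C c) qp qm .xm * Circle.gen (C c) qp qm .xp = 1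
    rw [smul_mul_assoc, h.xmxp, aeval_C, Algebra.algebraMap_eq_smul_one, inv_smul_smul₀ hc]

end Components

end CircleBundle

/-! ### The theorem -/

theorem theorem3p5 {K : Type*} [Field K] [CharZero K]
    (p pt : K[X]) (k : ℕ) (hp : p ≠ 0) (hroot : p.IsRoot 0) (hk : p.rootMultiplicity 0 = k)
    (hpt : p = X ^ k * pt)
    (q qp qm : K) (hq : q ≠ 0) (hqpm : q = qp * qm) :
    DirectSum.IsInternal (Circle.grading pt qp qm k) ∧
    IsStronglyGraded (Circle.veroneseGrading pt qp qm k) ∧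
    ∃ φ : Weyl p q 0 ≃ₐ[K] degreeZero (Circle.veroneseGrading pt qp qm k),
      (((φ (Weyl.gen p q 0 .x)).1.1 = Circle.gen pt qp qm .xm * Circle.gen pt qp qm .zp ^ k) ∧
        ((φ (Weyl.gen p q 0 .y)).1.1 = Circle.gen pt qp qm .zm ^ k * Circle.gen pt qp qm .xp) ∧
        ((φ (Weyl.gen p q 0 .z)).1.1 = Circle.gen pt qp qm .zp * Circle.gen pt qp qm .zm)) ∧
      ((∀ j : ℕ, 0 < j → q ^ j ≠ 1) →
        (IsNonDegenerateProjectivelyGraded (Circle.veroneseGrading pt qp qm k) ↔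
          ∃ ζ : AlgebraicClosure K, ζ ≠ 0 ∧ aeval ζ p = 0) ∧
        ∀ ζ : AlgebraicClosure K, ζ ≠ 0 → aeval ζ p = 0 →
          (∃! τ : Weyl p q 0 →ₗ[K] AlgebraicClosure K, IsTau p q ζ τ) ∧
          (∀ τ : Weyl p q 0 →ₗ[K] AlgebraicClosure K, IsTau p q ζ τ →
            (∀ a b : Weyl p q 0, τ (a * b) = τ (b * a)) ∧
            ∀ (n : ℤ) (N : ℕ)
              (E : Matrix (Fin N) (Fin N) (degreeZero (Circle.veroneseGrading pt qp qm k))),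
              IsIdempotentFor (Circle.veroneseGrading pt qp qm k) n E →
              τ (φ.symm E.trace) = -(n : AlgebraicClosure K)) ∧
          ∀ n : ℤ, n ≠ 0 → ¬ IsFreeComponent (Circle.veroneseGrading pt qp qm k) n) := by
  subst hpt hqpm
  have hqp : qp ≠ 0 := left_ne_zero_of_mul hq
  have hqm : qm ≠ 0 := right_ne_zero_of_mul hq
  have hpt0 : pt ≠ 0 := right_ne_zero_of_mul hp
  have hk0 : k ≠ 0 := by
    rw [← hk]
    exact ((rootMultiplicity_pos hp).2 hroot).ne'
  -- Otherwise `X ^ (k + 1)` would divide `p`, against the multiplicity of the root `0`.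
  have hpt : pt.eval 0 ≠ 0 := fun h => by
    have hdvd : (X - C 0) ^ (k + 1) ∣ X ^ k * pt := by
      rw [C_0, sub_zero, pow_succ]
      exact mul_dvd_mul_left _ (X_dvd_iff.2 (by rwa [coeff_zero_eq_eval_zero]))
    have := (le_rootMultiplicity_iff hp).2 hdvd
    omega
  have hroot0 {ζ : AlgebraicClosure K} (hζ0 : ζ ≠ 0) (hζ : aeval ζ (X ^ k * pt) = 0) :
      aeval ζ pt = 0 := by
    rw [map_mul, map_pow, aeval_X] at hζ
    exact (mul_eq_zero.1 hζ).resolve_left (pow_ne_zero _ hζ0)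
  refine ⟨Circle.isInternal_grading, isStronglyGraded_veroneseGrading hqp hqm hpt hk0,
    weylEquivDegreeZero hqp hqm hpt0 k,
    ⟨weylToCircle_gen k .x, weylToCircle_gen k .y, weylToCircle_gen k .z⟩, fun hq1 =>
    ⟨⟨fun hnd => ?_, fun ⟨ζ, hζ0, hζ⟩ => ?_⟩, fun ζ hζ0 hζ => ⟨?_, fun τ hτ =>
      ⟨Weyl.isTau_mul_comm hq hq1 hζ hroot hτ, fun n N E hE =>
        isTau_trace hqp hqm hpt hk0 hpt0 hq1 (hroot0 hζ0 hζ) hτ n hE⟩, fun n hn hfree => ?_⟩⟩⟩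
  · by_cases hdeg : pt.degree = 0
    · rw [eq_C_of_degree_eq_zero hdeg] at hnd
      have hc : pt.coeff 0 ≠ 0 := by rwa [coeff_zero_eq_eval_zero]
      obtain ⟨e⟩ := nonempty_leftComponent_one_equiv (qp := qp) (qm := qm) (k := k) hc
      exact ((hnd.not_iso 1 0 one_ne_zero).false e).elim
    · obtain ⟨ζ, hζ⟩ := IsAlgClosed.exists_aeval_eq_zero (AlgebraicClosure K) pt hdeg
      refine ⟨ζ, ?_, by simp [hζ]⟩
      rintro rfl
      rw [← map_zero (algebraMap K (AlgebraicClosure K)), aeval_algebraMap_apply,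
        coe_aeval_eq_eval] at hζ
      exact hpt ((algebraMap K _).injective hζ)
  · obtain ⟨τ, hτ⟩ := exists_isTau (L := AlgebraicClosure K) hqp hqm hpt0 k ζ
    refine ⟨⟨isInternal_veroneseGrading Circle.isInternal_grading hk0, fun n => ?_⟩,
      fun n _ => ?_, fun m n hmn => ⟨fun e => hmn ?_⟩⟩
    · obtain ⟨ι, _, a, b, h⟩ := exists_isDualFamily_veronese hqp hqm hpt hk0 n
      exact h.projective
    · obtain ⟨ι, _, a, b, h⟩ := exists_isDualFamily_veronese hqp hqm hpt hk0 n
      exact h.finite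
    · obtain ⟨ι, _, a, b, h⟩ := exists_isDualFamily_veronese hqp hqm hpt hk0 m
      obtain ⟨N, E, hE⟩ := exists_isIdempotentFor h
      obtain ⟨θ⟩ := hE.iso
      have hm := isTau_trace hqp hqm hpt hk0 hpt0 hq1 (hroot0 hζ0 hζ) hτ m hE
      -- Through `e` the same idempotent presents both components, so its trace has value both `-m`
      -- and `-n`; characteristic zero gives `m = n`.
      have hn := isTau_trace hqp hqm hpt hk0 hpt0 hq1 (hroot0 hζ0 hζ) hτ n
        ⟨hE.mul_self, ⟨e.symm.trans θ⟩⟩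
      exact_mod_cast neg_injective (hm.symm.trans hn)
  · obtain ⟨τ, hτ⟩ := exists_isTau (L := AlgebraicClosure K) hqp hqm hpt0 k ζ
    exact ⟨τ, hτ, fun τ' hτ' => Weyl.isTau_unique hq hτ' hτ⟩
  · obtain ⟨τ, hτ⟩ := exists_isTau (L := AlgebraicClosure K) hqp hqm hpt0 k ζ
    obtain ⟨ι, _, a, b, h⟩ := exists_isDualFamily_veronese hqp hqm hpt hk0 n
    obtain ⟨N, hN⟩ := isIdempotentFor_of_free h.finite hfree
    have htr := isTau_trace hqp hqm hpt hk0 hpt0 hq1 (hroot0 hζ0 hζ) hτ n hN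
    -- A free component is presented by an identity matrix, whose trace `N` is killed by `τ` since
    -- `τ(1) = 0`; but the value has to be `-n`.
    have h1 : τ 1 = 0 := by simpa using (hτ 0 0).1
    rw [Matrix.trace_one, map_natCast (weylEquivDegreeZero hqp hqm hpt0 k).symm,
      ← nsmul_one, map_nsmul, h1, smul_zero] at htr
    exact hn (by exact_mod_cast neg_eq_zero.1 htr.symm)
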